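/- A Steiner triple system of order $v$ is a pair $(V,\mathcal{B})$ where $V$ is a set of $v$ points and $\mathcal{B}$ is a collection of $3$-element subsets of $V$ (triples) such that any two distinct points occur together in exactly one triple. A partial parallel class is a set of pairwise disjoint triples of the system, and the chromatic index of $(V,\mathcal{B})$ is the smallest number of partial parallel classes into which $\mathcal{B}$ can be partitioned. Theorem. Let $v$ be a positive integer with $v \equiv 3 \pmod 6$. If $v \notin \{3, 9, 45, 75, 129, 513\}$, then there is a Steiner triple system of order $v$ with chromatic index at least $\frac{v+3}{2}$. If $v \in \{3, 9\}$, then there is no Steiner triple system of order $v$ with chromatic index at least $\frac{v+3}{2}$. (No claim is made for $v \in \{45, 75, 129, 513\}$.) -/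

import Mathlib

/-- A Steiner triple system on the finite point set `V`: a collection of 3-subsets of `V` such that
any two distinct points occur together in exactly one of them. Its order is the cardinality
of `V`. -/
structure SteinerTripleSystem (V : Type*) [Fintype V] where
  /-- the triples -/
  triples : Finset (Finset V)
  card_eq_three : ∀ t ∈ triples, t.card = 3
  existsUnique_triple : ∀ x y : V, x ≠ y → ∃! t : Finset V, t ∈ triples ∧ x ∈ t ∧ y ∈ t

namespace SteinerTripleSystem

/-- A partial parallel class: a set of triples of the system that are pairwise disjoint. -/
def IsPartialParallelClass {V : Type*} [Fintype V] (S : SteinerTripleSystem V)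
    (P : Finset (Finset V)) : Prop :=
  P ⊆ S.triples ∧ ∀ s ∈ P, ∀ t ∈ P, s ≠ t → Disjoint s t

open Classical in
/-- The triples of the system can be partitioned into exactly `k` partial parallel classes. -/
def HasPartition {V : Type*} [Fintype V] (S : SteinerTripleSystem V) (k : ℕ) : Prop :=
  ∃ Q : Finpartition S.triples, Q.parts.card = k ∧ ∀ P ∈ Q.parts, S.IsPartialParallelClass P

/-- The chromatic index: the smallest number of partial parallel classes into which the set of
triples can be partitioned. -/
noncomputable def chromaticIndex {V : Type*} [Fintype V] (S : SteinerTripleSystem V) : ℕ :=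
  sInf {k : ℕ | S.HasPartition k}

/-- A partition into partial parallel classes exists (take singletons), so the minimum that defines
the chromatic index is attained. -/
theorem hasPartition_chromaticIndex {V : Type*} [Fintype V] (S : SteinerTripleSystem V) :
    S.HasPartition S.chromaticIndex := by
  classical
  have h : {k : ℕ | S.HasPartition k}.Nonempty := by
    refine ⟨(⊥ : Finpartition S.triples).parts.card, ?_⟩
    refine ⟨⊥, by convert rfl, ?_⟩
    intro P hP
    have hP' : P ∈ (⊥ : Finpartition S.triples).parts := by convert hP
    obtain ⟨t, ht, rfl⟩ := Finpartition.mem_bot_iff.1 hP'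
    refine ⟨by simpa using ht, ?_⟩
    intro s hs u hu hsu
    rw [Finset.mem_singleton] at hs hu
    exact absurd (hs.trans hu.symm) hsu
  exact Nat.sInf_mem h

end SteinerTripleSystem

/-! Write v = 6k + 3. There are (2k + 1)(3k + 1) triples, and a partial parallel class has at most
2k + 1 of them, with equality exactly for parallel classes. Since (2k + 1)(3k + 1) = 2k(3k + 2) + (k
+ 1), a partition into at most 3k + 2 classes contains at least k + 1 disjoint parallel classes. So
it suffices to find a system and a set X of fewer than r(k + 1) triples such that every parallel
class contains at least r members of X (`le_chromaticIndex`). In each construction this follows by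
giving the points weights in an abelian group and summing over a parallel class.

For v ≡ 15 mod 18 the system is a Bose construction and X is the set of its v/3 vertical triples;
summing levels shows that their number in a parallel class is ≡ v/3 ≡ 2 mod 3. Order 21 is a Bose
construction over the nonzero vectors of a binary space, where a second weight rules out a single
vertical triple.

For the other residues, n = v - 2 is coprime to 6. Take `ZMod n` with two infinite points and the
triples of sum zero. The pairs {x, -2x} left over are joined to the infinite points, alternating
along the orbits of doubling up to sign. An orbit of odd length cannot alternate, so it receives one
local switch at a pair ±x. A parallel class without special triples would have nonzero total weight
(`exists_mem_special`). There are at most three special triples per odd orbit plus one, and odd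
orbits are few because an orbit of length l consists of solutions of (2^l ± 1)x = 0.

For order 3 there is one triple; for order 9 the system is an affine plane with four parallel
classes. -/

namespace SteinerTripleSystem

/-! ### Partitions as colourings, and the criterion for a large chromatic index. -/

theorem HasPartition.exists_coloring {V : Type*} [Fintype V] {S : SteinerTripleSystem V} {k : ℕ}
    (h : S.HasPartition k) :
    ∃ (f : Finset V → Finset (Finset V)) (C : Finset (Finset (Finset V))), C.card = k ∧
      (∀ s ∈ S.triples, f s ∈ C) ∧
      ∀ s ∈ S.triples, ∀ t ∈ S.triples, f s = f t → s ≠ t → Disjoint s t := by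
  classical
  obtain ⟨Q, hQ, hP⟩ := h
  refine ⟨fun s => Q.part s, Q.parts, hQ, fun s hs => ?_, fun s hs t ht hst hne => ?_⟩
  · exact Q.part_mem.2 hs
  · have h1 := hP _ (Q.part_mem.2 hs)
    refine h1.2 s (Q.mem_part_self.2 hs) t ?_ hne
    have h2 := Q.mem_part_self.2 ht
    have hst' : Q.part s = Q.part t := by convert hst
    rw [hst']
    exact h2

/-- A `Finpartition` has no empty part, so its parts are indexed by the colours in use; `D` only
bounds their number. -/
theorem chromaticIndex_le_of_coloring {V C : Type*} [Fintype V] (S : SteinerTripleSystem V)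
    (f : Finset V → C) (D : Finset C) (hD : ∀ s ∈ S.triples, f s ∈ D)
    (hf : ∀ s ∈ S.triples, ∀ t ∈ S.triples, f s = f t → s ≠ t → Disjoint s t) :
    S.chromaticIndex ≤ D.card := by
  classical
  have key : S.HasPartition (S.triples.image f).card := by
    let Q : Finpartition S.triples :=
      { parts := (S.triples.image f).image fun c => S.triples.filter fun s => f s = c
        supIndep := by
          rw [Finset.supIndep_iff_pairwiseDisjoint]
          intro a ha b hb hab
          simp only [Finset.coe_image, Set.mem_image, Finset.mem_coe] at ha hb
          obtain ⟨_, ⟨s, hs, rfl⟩, rfl⟩ := ha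
          obtain ⟨_, ⟨t, ht, rfl⟩, rfl⟩ := hb
          rw [Function.onFun, id, id, Finset.disjoint_left]
          intro u hu hu'
          rw [Finset.mem_filter] at hu hu'
          exact hab (by rw [← hu.2, ← hu'.2])
        sup_parts := by
          ext s
          simp only [Finset.mem_sup, Finset.mem_image, id]
          constructor
          · rintro ⟨_, ⟨_, ⟨t, ht, rfl⟩, rfl⟩, hs⟩
            exact (Finset.mem_filter.1 hs).1
          · intro hs
            exact ⟨_, ⟨_, ⟨s, hs, rfl⟩, rfl⟩, Finset.mem_filter.2 ⟨hs, rfl⟩⟩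
        bot_notMem := by
          rw [Finset.mem_image]
          rintro ⟨_, hc, hs⟩
          obtain ⟨s, hs', rfl⟩ := Finset.mem_image.1 hc
          have : s ∈ (⊥ : Finset (Finset V)) := by
            rw [← hs]; exact Finset.mem_filter.2 ⟨hs', rfl⟩
          simp at this }
    refine ⟨Q, ?_, ?_⟩
    · have h1 : Q.parts.card = (S.triples.image f).card := by
        refine Finset.card_image_of_injOn ?_
        intro a ha b hb hab
        obtain ⟨s, hs, rfl⟩ := Finset.mem_image.1 (Finset.mem_coe.1 ha)
        have h2 : s ∈ S.triples.filter fun u => f u = f s := Finset.mem_filter.2 ⟨hs, rfl⟩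
        simp only at hab
        rw [hab] at h2
        exact (Finset.mem_filter.1 h2).2
      exact h1
    · intro P hP
      obtain ⟨_, _, rfl⟩ := Finset.mem_image.1 hP
      refine ⟨Finset.filter_subset _ _, fun s hs t ht hst => ?_⟩
      rw [Finset.mem_filter] at hs ht
      exact hf s hs.1 t ht.1 (hs.2.trans ht.2.symm) hst
  refine (Nat.sInf_le key).trans (Finset.card_le_card ?_)
  intro c hc
  obtain ⟨s, hs, rfl⟩ := Finset.mem_image.1 hc
  exact hD s hs

/-- The image of a Steiner triple system under a bijection of the points. -/
def map {V W : Type*} [Fintype V] [Fintype W] (S : SteinerTripleSystem V) (e : V ≃ W) :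
    SteinerTripleSystem W where
  triples := S.triples.map (Finset.mapEmbedding e.toEmbedding).toEmbedding
  card_eq_three := by
    intro t ht
    obtain ⟨s, hs, rfl⟩ := Finset.mem_map.1 ht
    simpa using S.card_eq_three s hs
  existsUnique_triple := by
    intro x y hxy
    obtain ⟨t, ⟨ht, hx, hy⟩, hu⟩ :=
      S.existsUnique_triple (e.symm x) (e.symm y) (e.symm.injective.ne hxy)
    refine ⟨t.map e.toEmbedding, ⟨Finset.mem_map.2 ⟨t, ht, rfl⟩, ?_, ?_⟩, ?_⟩
    · exact Finset.mem_map.2 ⟨_, hx, by simp⟩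
    · exact Finset.mem_map.2 ⟨_, hy, by simp⟩
    · rintro u ⟨hu1, hxu, hyu⟩
      obtain ⟨s, hs, rfl⟩ := Finset.mem_map.1 hu1
      have := hu s ⟨hs, by simpa using hxu, by simpa using hyu⟩
      rw [this]; rfl

/-- Colourings pull back along a bijection. This direction carries a lower bound from a constructed
point set to `Fin v`. -/
theorem chromaticIndex_le_map {V W : Type*} [Fintype V] [Fintype W] (S : SteinerTripleSystem V)
    (e : V ≃ W) : S.chromaticIndex ≤ (S.map e).chromaticIndex := by
  obtain ⟨f, C, hC, hfC, hf⟩ := (S.map e).hasPartition_chromaticIndex.exists_coloring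
  rw [← hC]
  have hmem : ∀ s ∈ S.triples, s.map e.toEmbedding ∈ (S.map e).triples := fun s hs =>
    Finset.mem_map.2 ⟨s, hs, rfl⟩
  refine S.chromaticIndex_le_of_coloring (fun s => f (s.map e.toEmbedding)) C
    (fun s hs => hfC _ (hmem s hs)) fun s hs t ht h hst => ?_
  have := hf _ (hmem s hs) _ (hmem t ht) h (fun h' => hst (Finset.map_injective _ h'))
  rwa [Finset.disjoint_map] at this

/-- The ordered pairs of distinct points are partitioned by the triples, six to each. -/
theorem card_triples {V : Type*} [Fintype V] (S : SteinerTripleSystem V) :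
    6 * S.triples.card = Fintype.card V * (Fintype.card V - 1) := by
  classical
  have h1 : S.triples.biUnion (fun t => t.offDiag) = (Finset.univ : Finset V).offDiag := by
    ext ⟨x, y⟩
    simp only [Finset.mem_biUnion, Finset.mem_offDiag, Finset.mem_univ, true_and]
    constructor
    · rintro ⟨t, _, _, _, h⟩
      exact h
    · intro h
      obtain ⟨t, ⟨ht, hx, hy⟩, -⟩ := S.existsUnique_triple x y h
      exact ⟨t, ht, hx, hy, h⟩
  have h2 := congrArg Finset.card h1
  rw [Finset.card_biUnion, Finset.offDiag_card, Finset.sum_congr rfl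
    (fun t ht => by rw [Finset.offDiag_card, S.card_eq_three t ht])] at h2
  · rw [Finset.sum_const, Finset.card_univ] at h2
    rw [Nat.mul_sub, mul_one, ← h2]
    simp [mul_comm]
  · intro s hs t ht hst
    rw [Function.onFun, Finset.disjoint_left]
    rintro ⟨x, y⟩ hs' ht'
    rw [Finset.mem_offDiag] at hs' ht'
    exact hst ((S.existsUnique_triple x y hs'.2.2).unique ⟨hs, hs'.1, hs'.2.1⟩
      ⟨ht, ht'.1, ht'.2.1⟩)

theorem IsPartialParallelClass.card_biUnion {V : Type*} [Fintype V] [DecidableEq V]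
    {S : SteinerTripleSystem V} {P : Finset (Finset V)} (hP : S.IsPartialParallelClass P) :
    (P.biUnion id).card = 3 * P.card := by
  rw [Finset.card_biUnion (t := id) hP.2]
  simp only [id]
  rw [Finset.sum_congr rfl fun t ht => S.card_eq_three t (hP.1 ht)]
  simp [mul_comm]

/-- A parallel class: a partial parallel class that covers all points. -/
def IsParallelClass {V : Type*} [Fintype V] (S : SteinerTripleSystem V)
    (P : Finset (Finset V)) : Prop :=
  S.IsPartialParallelClass P ∧ ∀ x, ∃ t ∈ P, x ∈ t

theorem IsPartialParallelClass.isParallelClass {V : Type*} [Fintype V]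
    {S : SteinerTripleSystem V} {P : Finset (Finset V)} (hP : S.IsPartialParallelClass P)
    (h : Fintype.card V ≤ 3 * P.card) : S.IsParallelClass P := by
  classical
  refine ⟨hP, fun x => ?_⟩
  have h1 : P.biUnion id = Finset.univ :=
    Finset.eq_univ_of_card _ (le_antisymm (Finset.card_le_univ _) (h.trans hP.card_biUnion.ge))
  simpa using h1.ge (Finset.mem_univ x)

theorem IsParallelClass.card_eq {V : Type*} [Fintype V] {S : SteinerTripleSystem V}
    {P : Finset (Finset V)} (hP : S.IsParallelClass P) : 3 * P.card = Fintype.card V := by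
  classical
  rw [← hP.1.card_biUnion, ← Finset.card_univ]
  congr 1
  ext x
  simpa using hP.2 x

/-- The source of all obstructions: whatever the weights, the triple sums of a parallel class add up
to a total that does not depend on the class. -/
theorem IsParallelClass.sum_sum {V A : Type*} [Fintype V] [AddCommMonoid A]
    {S : SteinerTripleSystem V} {P : Finset (Finset V)} (hP : S.IsParallelClass P) (w : V → A) :
    ∑ t ∈ P, ∑ x ∈ t, w x = ∑ x, w x := by
  classical
  rw [← Finset.sum_biUnion hP.1.2]
  refine Finset.sum_congr ?_ fun _ _ => rfl
  ext x
  simpa using hP.2 x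

/-- If every parallel class meets a small set of triples often, then disjoint parallel classes are
so rare that many partial parallel classes are needed. -/
theorem le_chromaticIndex {V : Type*} [Fintype V] (S : SteinerTripleSystem V)
    {k : ℕ} (hV : Fintype.card V = 6 * k + 3) (X : Finset (Finset V)) (r : ℕ)
    (hX : X.card < r * (k + 1))
    (h : ∀ P, S.IsParallelClass P → ∃ Y ⊆ P, Y ⊆ X ∧ r ≤ Y.card) :
    3 * k + 3 ≤ S.chromaticIndex := by
  classical
  obtain ⟨Q, hQ, hP⟩ := S.hasPartition_chromaticIndex
  by_contra! hlt
  have hbound : ∀ P ∈ Q.parts, P.card ≤ 2 * k + 1 := fun P hPQ => by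
    have h1 := (hP P hPQ).card_biUnion
    have h2 := Finset.card_le_univ (P.biUnion id)
    omega
  set F := Q.parts.filter fun P => P.card = 2 * k + 1 with hF
  -- The full classes are disjoint, and each uses up at least `r` triples of `X`.
  have hFr : F.card * r ≤ X.card := by
    calc F.card * r = ∑ P ∈ F, r := by simp
      _ ≤ ∑ P ∈ F, (P ∩ X).card := Finset.sum_le_sum fun P hPF => by
        obtain ⟨h1, h2⟩ := Finset.mem_filter.1 hPF
        obtain ⟨Y, hYP, hYX, hY⟩ := h P ((hP P h1).isParallelClass (by omega))
        exact hY.trans (Finset.card_le_card (Finset.subset_inter hYP hYX))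
      _ = (F.biUnion fun P => P ∩ X).card := by
        refine (Finset.card_biUnion fun P h1 P' h2 hne => ?_).symm
        have h3 := Q.disjoint (Finset.mem_coe.2 (Finset.mem_filter.1 h1).1)
          (Finset.mem_coe.2 (Finset.mem_filter.1 h2).1) hne
        refine Finset.disjoint_left.2 fun t ht ht' => ?_
        exact Finset.disjoint_left.1 h3 (Finset.mem_inter.1 ht).1 (Finset.mem_inter.1 ht').1
      _ ≤ X.card := Finset.card_le_card fun t ht => by
        obtain ⟨P, _, h2⟩ := Finset.mem_biUnion.1 ht
        exact (Finset.mem_inter.1 h2).2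
  have hFk : F.card ≤ k := by
    by_contra! h1
    have h2 : (k + 1) * r ≤ F.card * r := Nat.mul_le_mul_right r h1
    rw [mul_comm r] at hX
    omega
  have hsum : S.triples.card ≤ 2 * k * S.chromaticIndex + F.card := by
    calc S.triples.card = ∑ P ∈ Q.parts, P.card := Q.sum_card_parts.symm
      _ ≤ ∑ P ∈ Q.parts, (2 * k + if P.card = 2 * k + 1 then 1 else 0) :=
        Finset.sum_le_sum fun P hPQ => by
          have := hbound P hPQ
          split_ifs <;> omega
      _ = 2 * k * S.chromaticIndex + F.card := by
        rw [Finset.sum_add_distrib, Finset.sum_const, Finset.sum_boole, ← hQ]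
        simp [hF, mul_comm]
  have hT := S.card_triples
  -- Together with `hsum` this gives (2k + 1)(3k + 1) ≤ 2k(3k + 2) + |F|, hence |F| ≥ k + 1, against
  -- `hFk`.
  have h3 : 2 * k * S.chromaticIndex ≤ 2 * k * (3 * k + 2) := Nat.mul_le_mul_left _ (by omega)
  rw [hV, show 6 * k + 3 - 1 = 6 * k + 2 by omega] at hT
  nlinarith

theorem exists_fin_of_le_chromaticIndex {V : Type*} [Fintype V] (S : SteinerTripleSystem V)
    {v k : ℕ} (hV : Fintype.card V = v) (hk : v = 6 * k + 3)
    (h : 3 * k + 3 ≤ S.chromaticIndex) :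
    ∃ S' : SteinerTripleSystem (Fin v), ((v : ℚ) + 3) / 2 ≤ (S'.chromaticIndex : ℚ) := by
  refine ⟨S.map (Fintype.equivFinOfCardEq hV), ?_⟩
  have h1 := h.trans (S.chromaticIndex_le_map (Fintype.equivFinOfCardEq hV))
  have h2 : ((3 * k + 3 : ℕ) : ℚ) ≤ ((S.map (Fintype.equivFinOfCardEq hV)).chromaticIndex : ℚ) := by
    exact_mod_cast h1
  refine le_trans (le_of_eq ?_) h2
  rw [hk]
  push_cast
  ring

end SteinerTripleSystem

/-! ### Steiner quasigroups and their triple systems. -/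

/-- A Steiner quasigroup: `third x y` is the third point of the triple through `x` and `y`. -/
structure SteinerQuasigroup (V : Type*) where
  third : V → V → V
  third_self : ∀ x, third x x = x
  third_comm : ∀ x y, third x y = third y x
  third_third : ∀ x y, third x (third x y) = y

namespace SteinerQuasigroup

theorem third_ne_left {V : Type*} (Q : SteinerQuasigroup V) {x y : V} (h : x ≠ y) :
    Q.third x y ≠ x := fun h' => by
  have := Q.third_third x y
  rw [h', Q.third_self] at this
  exact h this

theorem third_ne_right {V : Type*} (Q : SteinerQuasigroup V) {x y : V} (h : x ≠ y) :
    Q.third x y ≠ y := by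
  rw [Q.third_comm]
  exact Q.third_ne_left h.symm

theorem third_third_right {V : Type*} (Q : SteinerQuasigroup V) (x y : V) :
    Q.third y (Q.third x y) = x := by
  rw [Q.third_comm x y, Q.third_third]

theorem triple_eq {V : Type*} [DecidableEq V] (Q : SteinerQuasigroup V) {a b x y : V}
    (hxy : x ≠ y) (hx : x ∈ ({a, b, Q.third a b} : Finset V))
    (hy : y ∈ ({a, b, Q.third a b} : Finset V)) :
    ({a, b, Q.third a b} : Finset V) = {x, y, Q.third x y} := by
  simp only [Finset.mem_insert, Finset.mem_singleton] at hx hy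
  have h1 := Q.third_third a b
  have h2 := Q.third_third_right a b
  have h3 := Q.third_comm
  ext z
  simp only [Finset.mem_insert, Finset.mem_singleton]
  grind

/-- The Steiner triple system of a Steiner quasigroup. -/
def toSteinerTripleSystem {V : Type*} [Fintype V] [DecidableEq V] (Q : SteinerQuasigroup V) :
    SteinerTripleSystem V where
  triples := (Finset.univ : Finset V).offDiag.image fun p => {p.1, p.2, Q.third p.1 p.2}
  card_eq_three := by
    intro t ht
    obtain ⟨⟨x, y⟩, h, rfl⟩ := Finset.mem_image.1 ht
    have h' : x ≠ y := (Finset.mem_offDiag.1 h).2.2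
    exact Finset.card_eq_three.2
      ⟨_, _, _, h', (Q.third_ne_left h').symm, (Q.third_ne_right h').symm, rfl⟩
  existsUnique_triple := by
    intro x y hxy
    refine ⟨{x, y, Q.third x y}, ⟨Finset.mem_image.2 ⟨(x, y), by simpa using hxy, rfl⟩, by simp,
      by simp⟩, ?_⟩
    rintro t ⟨ht, hx, hy⟩
    obtain ⟨⟨a, b⟩, h, rfl⟩ := Finset.mem_image.1 ht
    exact Q.triple_eq hxy hx hy

theorem mem_triples {V : Type*} [Fintype V] [DecidableEq V] (Q : SteinerQuasigroup V)
    {t : Finset V} :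
    t ∈ Q.toSteinerTripleSystem.triples ↔ ∃ x y, x ≠ y ∧ t = {x, y, Q.third x y} := by
  simp [toSteinerTripleSystem, eq_comm]

/-- A triple is determined by any of its points. -/
theorem exists_eq_of_mem {V : Type*} [Fintype V] [DecidableEq V] (Q : SteinerQuasigroup V)
    {t : Finset V} (ht : t ∈ Q.toSteinerTripleSystem.triples) {x : V} (hx : x ∈ t) :
    ∃ y, x ≠ y ∧ t = {x, y, Q.third x y} := by
  obtain ⟨a, b, hab, rfl⟩ := Q.mem_triples.1 ht
  rcases eq_or_ne x a with rfl | hxa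
  · exact ⟨b, hab, rfl⟩
  · exact ⟨a, hxa, Q.triple_eq hxa hx (by simp)⟩

theorem sum_triple {V A : Type*} [DecidableEq V] [AddCommMonoid A] (Q : SteinerQuasigroup V)
    {x y : V} (h : x ≠ y) (w : V → A) :
    ∑ z ∈ ({x, y, Q.third x y} : Finset V), w z = w x + (w y + w (Q.third x y)) := by
  rw [Finset.sum_insert, Finset.sum_pair (Q.third_ne_right h).symm]
  simp [h, (Q.third_ne_left h).symm]

end SteinerQuasigroup

/-! ### The Bose construction. -/

/-- An idempotent commutative quasigroup with its left division. -/
structure IdempotentCommQuasigroup (Q : Type*) where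
  op : Q → Q → Q
  ldiv : Q → Q → Q
  op_self : ∀ x, op x x = x
  op_comm : ∀ x y, op x y = op y x
  op_ldiv : ∀ x y, op x (ldiv x y) = y
  ldiv_op : ∀ x y, ldiv x (op x y) = y

namespace IdempotentCommQuasigroup

theorem ldiv_ne_left {Q : Type*} (B : IdempotentCommQuasigroup Q) {x y : Q} (h : x ≠ y) :
    B.ldiv x y ≠ x := fun h' => h <| by
  have := B.op_ldiv x y
  rwa [h', B.op_self] at this

theorem ldiv_ne_right {Q : Type*} (B : IdempotentCommQuasigroup Q) {x y : Q} (h : x ≠ y) :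
    B.ldiv x y ≠ y := fun h' => h <| by
  have h1 := B.op_ldiv x y
  rw [h', B.op_comm] at h1
  have h2 := B.ldiv_op y x
  have h3 := B.ldiv_op y y
  rw [h1] at h2
  rw [B.op_self] at h3
  rw [← h2, h3]

theorem op_ne_left {Q : Type*} (B : IdempotentCommQuasigroup Q) {x y : Q} (h : x ≠ y) :
    B.op x y ≠ x := fun h' => h <| by
  have h2 := B.ldiv_op x y
  have h3 := B.ldiv_op x x
  rw [h'] at h2
  rw [B.op_self] at h3
  rw [← h2, h3]

theorem ldiv_ldiv {Q : Type*} (B : IdempotentCommQuasigroup Q) (x y : Q) :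
    B.ldiv (B.ldiv y x) x = y := by
  have h := B.ldiv_op (B.ldiv y x) y
  rwa [B.op_comm, B.op_ldiv] at h

/-- The third point of a triple of the Bose construction. -/
def boseThird {Q : Type*} [DecidableEq Q] (B : IdempotentCommQuasigroup Q) (p q : Q × ZMod 3) :
    Q × ZMod 3 :=
  if p.2 = q.2 then if p.1 = q.1 then p else (B.op p.1 q.1, p.2 + 1)
  else if p.1 = q.1 then (p.1, -(p.2 + q.2))
  -- A point one level up must be the product of `p.1` and the missing first coordinate, which left
  -- division recovers.
  else if q.2 = p.2 + 1 then (B.ldiv p.1 q.1, p.2)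
  else (B.ldiv q.1 p.1, q.2)

/-- The Bose construction. -/
def bose {Q : Type*} [DecidableEq Q] (B : IdempotentCommQuasigroup Q) :
    SteinerQuasigroup (Q × ZMod 3) where
  third := B.boseThird
  third_self := by simp [boseThird]
  third_comm := by
    rintro ⟨x, i⟩ ⟨y, j⟩
    -- Of two different levels modulo three, exactly one is the successor of the other.
    have hij : i ≠ j → (j = i + 1 ↔ ¬ i = j + 1) := by revert i j; decide
    by_cases h1 : i = j
    · by_cases h2 : x = y
      · subst h1 h2; rfl
      · simp [boseThird, h1, h2, Ne.symm h2, B.op_comm x y]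
    · by_cases h2 : x = y
      · simp [boseThird, h1, h2, Ne.symm h1, add_comm]
      · by_cases h3 : i = j + 1
        · simp [boseThird, h1, h2, Ne.symm h1, Ne.symm h2, hij h1, ← h3]
        · simp [boseThird, h1, h2, Ne.symm h1, Ne.symm h2, hij h1, h3]
  third_third := by
    rintro ⟨x, i⟩ ⟨y, j⟩
    have hij : i ≠ j → (j = i + 1 ↔ ¬ i = j + 1) := by revert i j; decide
    have hij' : i ≠ j → i ≠ -(i + j) := by revert i j; decide
    by_cases h1 : i = j
    · by_cases h2 : x = y
      · simp [boseThird, h1, h2]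
      · simp [boseThird, h1, h2, (B.op_ne_left h2).symm, B.ldiv_op]
    · by_cases h2 : x = y
      · have := hij' h1
        simp only [boseThird, h1, h2, if_true, if_false, this]
        simp
      · by_cases h3 : i = j + 1
        · simp [boseThird, h1, h2, hij h1, ← h3, (B.ldiv_ne_right (Ne.symm h2)).symm, B.ldiv_ldiv]
        · have h4 := (hij h1).2 h3
          subst h4
          simp [boseThird, h2, (B.ldiv_ne_left h2).symm, B.op_ldiv]

/-- The vertical triples of the Bose construction. -/
def vertical {Q : Type*} [Fintype Q] [DecidableEq Q] : Finset (Finset (Q × ZMod 3)) :=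
  Finset.univ.image fun x => {(x, 0), (x, 1), (x, 2)}

/-- A normal form for computing weights: every nonvertical triple has two points on one level and
its third on the next. -/
theorem bose_triple {Q : Type*} [Fintype Q] [DecidableEq Q] (B : IdempotentCommQuasigroup Q)
    {t : Finset (Q × ZMod 3)} (ht : t ∈ B.bose.toSteinerTripleSystem.triples) :
    t ∈ (vertical : Finset (Finset (Q × ZMod 3))) ∨
      ∃ x y i, x ≠ y ∧ t = {(x, i), (y, i), B.bose.third (x, i) (y, i)} := by
  obtain ⟨⟨x, i⟩, ⟨y, j⟩, h, rfl⟩ := B.bose.mem_triples.1 ht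
  have hij : i ≠ j → (j = i + 1 ↔ ¬ i = j + 1) := by clear h ht; revert i j; decide
  by_cases h1 : i = j
  · subst h1
    exact Or.inr ⟨x, y, i, by simpa using h, rfl⟩
  · by_cases h2 : x = y
    · subst h2
      left
      refine Finset.mem_image.2 ⟨x, Finset.mem_univ _, ?_⟩
      have h3 : B.bose.third (x, i) (x, j) = (x, -(i + j)) := by simp [bose, boseThird, h1]
      have h4 : ∀ k : ZMod 3, (k = 0 ∨ k = 1 ∨ k = 2) ↔ (k = i ∨ k = j ∨ k = -(i + j)) := by
        clear h h3 ht hij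
        revert i j; decide
      rw [h3]
      ext ⟨z, k⟩
      have := h4 k
      simp only [Finset.mem_insert, Finset.mem_singleton, Prod.mk.injEq]
      tauto
    · right
      by_cases h3 : i = j + 1
      · refine ⟨B.ldiv y x, y, j, B.ldiv_ne_left (Ne.symm h2), ?_⟩
        refine B.bose.triple_eq ?_ ?_ ?_
        · simpa using B.ldiv_ne_left (Ne.symm h2)
        · simp [bose, boseThird, h1, h2, hij h1, ← h3]
        · simp
      · refine ⟨x, B.ldiv x y, i, (B.ldiv_ne_left h2).symm, ?_⟩
        refine B.bose.triple_eq ?_ ?_ ?_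
        · simpa using (B.ldiv_ne_left h2).symm
        · simp
        · simp [bose, boseThird, h2, (hij h1).2 h3]

theorem sum_bose_triple {Q A : Type*} [DecidableEq Q] [AddCommMonoid A]
    (B : IdempotentCommQuasigroup Q) {x y : Q} (h : x ≠ y) (i : ZMod 3) (w : Q × ZMod 3 → A) :
    ∑ p ∈ ({(x, i), (y, i), B.bose.third (x, i) (y, i)} : Finset (Q × ZMod 3)), w p =
      w (x, i) + (w (y, i) + w (B.op x y, i + 1)) := by
  rw [B.bose.sum_triple (by simpa using h)]
  simp [bose, boseThird, h]

theorem sum_vertical {Q A : Type*} [DecidableEq Q] [AddCommMonoid A] (x : Q)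
    (w : Q × ZMod 3 → A) :
    ∑ p ∈ ({(x, 0), (x, 1), (x, 2)} : Finset (Q × ZMod 3)), w p =
      w (x, 0) + (w (x, 1) + w (x, 2)) := by
  have h1 : (0 : ZMod 3) ≠ 1 := by decide
  have h2 : (0 : ZMod 3) ≠ 2 := by decide
  have h3 : (1 : ZMod 3) ≠ 2 := by decide
  rw [Finset.sum_insert, Finset.sum_pair] <;> simp [h1, h2, h3]

/-- A parallel class of a Bose system of order `3 * n` has `n` vertical triples modulo three. -/
theorem card_vertical_modEq {Q : Type*} [Fintype Q] [DecidableEq Q]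
    (B : IdempotentCommQuasigroup Q) {P : Finset (Finset (Q × ZMod 3))}
    (hP : B.bose.toSteinerTripleSystem.IsParallelClass P) :
    (P ∩ vertical).card ≡ Fintype.card Q [MOD 3] := by
  have hcard : P.card = Fintype.card Q := by
    have := hP.card_eq
    rw [Fintype.card_prod, ZMod.card] at this
    omega
  -- The weight is the level modulo three. A nonvertical triple has sum 3i + 1 = 1, a vertical one
  -- has sum 0, and all points together have sum 0.
  have h1 := hP.sum_sum (fun p => p.2)
  have h2 : ∑ p : Q × ZMod 3, p.2 = 0 := by
    rw [Fintype.sum_prod_type]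
    have : ∑ i : ZMod 3, i = 0 := by decide
    simp [this]
  have h3 : ∀ t ∈ P, ∑ p ∈ t, p.2 =
      1 - if t ∈ (vertical : Finset (Finset (Q × ZMod 3))) then 1 else 0 := by
    intro t ht
    split_ifs with hv
    · obtain ⟨x, -, rfl⟩ := Finset.mem_image.1 hv
      rw [sum_vertical]
      have : (0 : ZMod 3) + (1 + 2) = 1 - 1 := by decide
      exact this
    · obtain ⟨x, y, i, hxy, rfl⟩ := (B.bose_triple (hP.1.1 ht)).resolve_left hv
      rw [B.sum_bose_triple hxy]
      have : ∀ i : ZMod 3, i + (i + (i + 1)) = 1 - 0 := by decide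
      exact this i
  rw [h2, Finset.sum_congr rfl h3, Finset.sum_sub_distrib, Finset.sum_boole,
    Finset.filter_mem_eq_inter, sub_eq_zero] at h1
  rw [← ZMod.natCast_eq_natCast_iff, ← h1, ← hcard]
  simp

theorem card_vertical_le {Q : Type*} [Fintype Q] [DecidableEq Q] :
    (vertical : Finset (Finset (Q × ZMod 3))).card ≤ Fintype.card Q :=
  Finset.card_image_le

/-- The nonzero vectors of a vector space over the field with two elements. -/
def ofBinary (A : Type*) [AddCommGroup A] [DecidableEq A] (h : ∀ x : A, x + x = 0) :
    IdempotentCommQuasigroup {x : A // x ≠ 0} :=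
  let op : {x : A // x ≠ 0} → {x : A // x ≠ 0} → {x : A // x ≠ 0} := fun x y =>
    if hxy : x = y then x else ⟨x.1 + y.1, fun h' => hxy <| Subtype.ext <| by
      rw [eq_neg_of_add_eq_zero_left h', ← eq_neg_of_add_eq_zero_left (h y.1)]⟩
  have hop : ∀ x y, op x (op x y) = y := fun x y => by
    by_cases hxy : x = y
    · simp [op, hxy]
    · have h1 : (x.1 + (x.1 + y.1)) = y.1 := by rw [← add_assoc, h, zero_add]
      have h2 : x ≠ op x y := fun h' => y.2 <| by
        have := congrArg Subtype.val h'
        simpa [op, hxy] using this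
      apply Subtype.ext
      simp only [op, hxy, dite_false]
      rw [dif_neg (by simpa [op, hxy] using h2)]
      exact h1
  { op := op
    ldiv := op
    op_self := fun x => by simp [op]
    op_comm := fun x y => by
      by_cases hxy : x = y
      · simp [hxy]
      · simp [op, hxy, Ne.symm hxy, add_comm]
    op_ldiv := hop
    ldiv_op := hop }

/-- Midpoints in a ring in which two is invertible. -/
def midpoint (R : Type*) [CommRing R] (c : R) (hc : 2 * c = 1) : IdempotentCommQuasigroup R where
  op x y := (x + y) * c
  ldiv x y := 2 * y - x
  op_self x := by linear_combination x * hc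
  op_comm x y := by ring
  op_ldiv x y := by linear_combination y * hc
  ldiv_op x y := by linear_combination (x + y) * hc

end IdempotentCommQuasigroup

/-! ### Orders congruent to 15 modulo 18, and order 21. -/

theorem exists_highIndex_of_mod_eighteen_eq_fifteen {v : ℕ} (hv : v % 18 = 15) :
    ∃ S : SteinerTripleSystem (Fin v), ((v : ℚ) + 3) / 2 ≤ (S.chromaticIndex : ℚ) := by
  obtain ⟨j, rfl⟩ : ∃ j, v = 18 * j + 15 := ⟨v / 18, by omega⟩
  have hc : (2 : ZMod (6 * j + 5)) * ((3 * j + 3 : ℕ) : ZMod (6 * j + 5)) = 1 := by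
    have : ((6 * j + 5 : ℕ) : ZMod (6 * j + 5)) = 0 := ZMod.natCast_self _
    push_cast at this ⊢
    linear_combination this
  have : NeZero (6 * j + 5) := ⟨by omega⟩
  let B := IdempotentCommQuasigroup.midpoint (ZMod (6 * j + 5)) _ hc
  have hV : Fintype.card (ZMod (6 * j + 5) × ZMod 3) = 18 * j + 15 := by
    rw [Fintype.card_prod, ZMod.card, ZMod.card]
    ring
  refine B.bose.toSteinerTripleSystem.exists_fin_of_le_chromaticIndex hV
    (k := 3 * j + 2) (by ring) ?_
  -- The number 6j + 5 of columns is 2 modulo 3, so a parallel class has at least two vertical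
  -- triples; and 6j + 5 = 2k + 1 < 2(k + 1).
  refine SteinerTripleSystem.le_chromaticIndex _ (by rw [hV]; ring)
    IdempotentCommQuasigroup.vertical 2 ?_ fun P hP => ?_
  · refine IdempotentCommQuasigroup.card_vertical_le.trans_lt ?_
    rw [ZMod.card]
    omega
  · refine ⟨_, Finset.inter_subset_left, Finset.inter_subset_right, ?_⟩
    have h1 := B.card_vertical_modEq hP
    rw [ZMod.card] at h1
    unfold Nat.ModEq at h1
    omega

theorem exists_highIndex_twentyOne :
    ∃ S : SteinerTripleSystem (Fin 21), (((21 : ℕ) : ℚ) + 3) / 2 ≤ (S.chromaticIndex : ℚ) := by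
  let A := Fin 3 → ZMod 2
  have hA : ∀ x : A, x + x = 0 := by decide
  let B := IdempotentCommQuasigroup.ofBinary A hA
  have hQ : Fintype.card {x : A // x ≠ 0} = 7 := by decide
  have hV : Fintype.card ({x : A // x ≠ 0} × ZMod 3) = 21 := by
    rw [Fintype.card_prod, ZMod.card, hQ]
  refine B.bose.toSteinerTripleSystem.exists_fin_of_le_chromaticIndex hV (k := 3) (by norm_num) ?_
  refine SteinerTripleSystem.le_chromaticIndex _ (by rw [hV])
    IdempotentCommQuasigroup.vertical 2 ?_ fun P hP => ?_
  · refine IdempotentCommQuasigroup.card_vertical_le.trans_lt ?_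
    rw [hQ]
    norm_num
  · refine ⟨_, Finset.inter_subset_left, Finset.inter_subset_right, ?_⟩
    have h1 := B.card_vertical_modEq hP
    rw [hQ] at h1
    unfold Nat.ModEq at h1
    have h2 : (P ∩ IdempotentCommQuasigroup.vertical).card ≠ 1 := fun h => by
      obtain ⟨t, ht⟩ := Finset.card_eq_one.1 h
      have htP : t ∈ P ∧ t ∈ IdempotentCommQuasigroup.vertical :=
        Finset.mem_inter.1 (by rw [ht]; exact Finset.mem_singleton_self t)
      -- The residue 1 modulo 3 still allows a single vertical triple. With the binary vector as
      -- weight, nonvertical triples and the total have sum 0, while a vertical triple over x has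
      -- sum 3x = x ≠ 0.
      have h3 := hP.sum_sum (fun p => p.1.1)
      have h4 : ∑ p : {x : A // x ≠ 0} × ZMod 3, p.1.1 = 0 := by
        rw [Fintype.sum_prod_type]
        decide
      obtain ⟨x, -, rfl⟩ := Finset.mem_image.1 htP.2
      rw [h4, Finset.sum_eq_single_of_mem _ htP.1,
        IdempotentCommQuasigroup.sum_vertical, hA, add_zero] at h3
      · exact x.2 h3
      · intro s hs hst
        have hsv : s ∉ IdempotentCommQuasigroup.vertical := fun hsv => hst <| by
          have : s ∈ P ∩ IdempotentCommQuasigroup.vertical := Finset.mem_inter.2 ⟨hs, hsv⟩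
          rw [ht] at this
          exact Finset.mem_singleton.1 this
        obtain ⟨y, z, i, hyz, rfl⟩ := (B.bose_triple (hP.1.1 hs)).resolve_left hsv
        rw [B.sum_bose_triple hyz]
        simp only [B, IdempotentCommQuasigroup.ofBinary, hyz, dite_false]
        rw [← add_assoc, hA]
    omega

/-! ### The system of a doubling colouring. -/

/-- A two-colouring of the elements of a ring, negation-invariant, that changes under doubling
except at the elements `±x` with `x ∈ reps`. -/
structure DoublingColoring (R : Type*) [CommRing R] where
  half : R
  two_mul_half : 2 * half = 1
  eq_zero_of_three_mul : ∀ x : R, 3 * x = 0 → x = 0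
  reps : Finset R
  color : R → Bool
  zero_notMem : (0 : R) ∉ reps
  color_neg : ∀ x, color (-x) = color x
  color_two_mul : ∀ x, x ≠ 0 → x ∉ reps → -x ∉ reps → color (2 * x) = !color x
  color_of_mem : ∀ x ∈ reps, color x = true
  color_two_mul_of_mem : ∀ x ∈ reps, color (2 * x) = true
  two_mul_notMem : ∀ x ∈ reps, 2 * x ∉ reps ∧ -(2 * x) ∉ reps

namespace DoublingColoring

variable {R : Type*} [CommRing R]

/-- The exceptional elements of a doubling colouring. -/
def Exc (C : DoublingColoring R) (x : R) : Prop := x ∈ C.reps ∨ -x ∈ C.reps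

instance [DecidableEq R] (C : DoublingColoring R) (x : R) : Decidable (C.Exc x) :=
  inferInstanceAs (Decidable (_ ∨ _))

theorem exc_neg (C : DoublingColoring R) (x : R) : C.Exc (-x) ↔ C.Exc x := by
  simp [Exc, or_comm]

theorem color_two_mul_of_not_exc (C : DoublingColoring R) {x : R} (h0 : x ≠ 0) (h : ¬ C.Exc x) :
    C.color (2 * x) = !C.color x :=
  C.color_two_mul x h0 (fun h' => h (Or.inl h')) fun h' => h (Or.inr h')

theorem color_of_exc (C : DoublingColoring R) {x : R} (h : C.Exc x) : C.color x = true := by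
  rcases h with h | h
  · exact C.color_of_mem x h
  · rw [← C.color_neg]
    exact C.color_of_mem _ h

theorem color_two_mul_of_exc (C : DoublingColoring R) {x : R} (h : C.Exc x) :
    C.color (2 * x) = true := by
  rcases h with h | h
  · exact C.color_two_mul_of_mem x h
  · rw [← C.color_neg, ← mul_neg]
    exact C.color_two_mul_of_mem _ h

theorem not_exc_two_mul (C : DoublingColoring R) {x : R} (h : C.Exc x) : ¬ C.Exc (2 * x) := by
  rcases h with h | h
  · have := C.two_mul_notMem x h
    simpa [Exc] using this
  · have := C.two_mul_notMem _ h
    rw [← C.exc_neg]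
    simpa [Exc] using this

theorem two_mul_half_mul (C : DoublingColoring R) (x : R) : 2 * (C.half * x) = x := by
  linear_combination x * C.two_mul_half

theorem half_mul_two_mul (C : DoublingColoring R) (x : R) : C.half * (2 * x) = x := by
  linear_combination x * C.two_mul_half

theorem half_mul_ne_zero (C : DoublingColoring R) {x : R} (h : x ≠ 0) : C.half * x ≠ 0 :=
  fun h' => h <| by rw [← C.two_mul_half_mul x, h', mul_zero]

theorem two_mul_ne_zero (C : DoublingColoring R) {x : R} (h : x ≠ 0) : 2 * x ≠ 0 :=
  fun h' => h <| by rw [← C.half_mul_two_mul x, h', mul_zero]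

theorem not_exc_of_half (C : DoublingColoring R) {x : R} (h : C.Exc (C.half * x)) : ¬ C.Exc x := by
  have := C.not_exc_two_mul h
  rwa [C.two_mul_half_mul] at this

theorem color_of_exc_half (C : DoublingColoring R) {x : R} (h : C.Exc (C.half * x)) :
    C.color x = true := by
  have := C.color_two_mul_of_exc h
  rwa [C.two_mul_half_mul] at this

theorem color_half (C : DoublingColoring R) {x : R} (h0 : x ≠ 0) (h : ¬ C.Exc (C.half * x)) :
    C.color (C.half * x) = !C.color x := by
  have := C.color_two_mul_of_not_exc (C.half_mul_ne_zero h0) h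
  rw [C.two_mul_half_mul] at this
  simp [this]

theorem eq_zero_of_eq_neg_two_mul (C : DoublingColoring R) {x : R} (h : x = -(2 * x)) : x = 0 :=
  C.eq_zero_of_three_mul x (by linear_combination h)

theorem eq_zero_of_eq_neg (C : DoublingColoring R) {x : R} (h : x = -x) : x = 0 := by
  by_contra h0
  exact C.two_mul_ne_zero h0 (by linear_combination h)

/-- The weight of a point: finite points weigh themselves. -/
def weight : R ⊕ Bool → R := Sum.elim id 0

theorem sum_weight [Fintype R] (C : DoublingColoring R) : ∑ p : R ⊕ Bool, weight p = 0 := by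
  rw [Fintype.sum_sum_type]
  simp only [weight, Sum.elim_inl, Sum.elim_inr, id, Pi.zero_apply, Finset.sum_const_zero,
    add_zero]
  refine C.eq_zero_of_eq_neg ?_
  rw [← Finset.sum_neg_distrib]
  exact (Equiv.sum_comp (Equiv.neg R) fun x => x).symm

variable [DecidableEq R]

/-- The third point of the triple through `0` and `x`. -/
def zeroThird (C : DoublingColoring R) (x : R) : R :=
  -- The switch at an exceptional x consists of {0, x, -2x}, {0, -x, 2x}, {x, -x, ∞_true} and {2x,
  -- -2x, ∞_false}. It stands in for {0, x, -x}, {0, 2x, -2x} and the two triples joining ±x to ∓2x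
  -- through an infinite point. This works because x and 2x share the colour `true`.
  if C.Exc x then -(2 * x) else if C.Exc (C.half * x) then -(C.half * x) else -x

/-- The third point of the triple through `x` and the infinite point `c`. -/
def infThird (C : DoublingColoring R) (x : R) (c : Bool) : R ⊕ Bool :=
  if x = 0 then .inr !c
  else if C.color x = c then .inl (if C.Exc x then -x else -(2 * x))
  else .inl (if C.Exc (C.half * x) then -x else -(C.half * x))

/-- The third point of the triple through the finite points `x` and `y`. -/
def finThird (C : DoublingColoring R) (x y : R) : R ⊕ Bool :=
  if x = y then .inl x
  else if y = -(2 * x) then if C.Exc x then .inl 0 else .inr (C.color x)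
  else if x = -(2 * y) then if C.Exc y then .inl 0 else .inr (C.color y)
  else if y = -x then
    if C.Exc x then .inr true else if C.Exc (C.half * x) then .inr false else .inl 0
  else if x = 0 then .inl (C.zeroThird y)
  else if y = 0 then .inl (C.zeroThird x)
  else .inl (-(x + y))

/-- The third point of a triple of the system of a doubling colouring. -/
def third (C : DoublingColoring R) : R ⊕ Bool → R ⊕ Bool → R ⊕ Bool
  | .inl x, .inl y => C.finThird x y
  | .inl x, .inr c => C.infThird x c
  | .inr c, .inl x => C.infThird x c
  | .inr c, .inr d => if c = d then .inr c else .inl 0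

theorem finThird_neg_two_mul (C : DoublingColoring R) {x : R} (h : x ≠ 0) :
    C.finThird x (-(2 * x)) = if C.Exc x then .inl 0 else .inr (C.color x) := by
  rw [finThird, if_neg (fun h' => h (C.eq_zero_of_eq_neg_two_mul h')), if_pos rfl]

theorem finThird_neg_two_mul_left (C : DoublingColoring R) {x : R} (h : x ≠ 0) :
    C.finThird (-(2 * x)) x = if C.Exc x then .inl 0 else .inr (C.color x) := by
  rw [finThird, if_neg (fun h' => h (C.eq_zero_of_eq_neg_two_mul h'.symm)), if_neg, if_pos rfl]
  intro h'
  exact h (C.eq_zero_of_three_mul x (by linear_combination -h'))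

theorem finThird_neg (C : DoublingColoring R) {x : R} (h : x ≠ 0) :
    C.finThird x (-x) =
      if C.Exc x then .inr true else if C.Exc (C.half * x) then .inr false else .inl 0 := by
  rw [finThird, if_neg, if_neg, if_neg, if_pos rfl]
  · exact fun h' => h (by linear_combination -h')
  · exact fun h' => h (by linear_combination h')
  · exact fun h' => h (C.eq_zero_of_eq_neg h')

theorem finThird_zero_left (C : DoublingColoring R) {x : R} (h : x ≠ 0) :
    C.finThird 0 x = .inl (C.zeroThird x) := by
  have := C.two_mul_ne_zero h
  simp [finThird, h.symm, h, this]

theorem finThird_zero_right (C : DoublingColoring R) {x : R} (h : x ≠ 0) :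
    C.finThird x 0 = .inl (C.zeroThird x) := by
  have := C.two_mul_ne_zero h
  simp [finThird, h, this]

theorem finThird_of_ne (C : DoublingColoring R) {x y : R} (h : x ≠ y) (hx : x ≠ 0) (hy : y ≠ 0)
    (h1 : y ≠ -(2 * x)) (h2 : x ≠ -(2 * y)) (h3 : y ≠ -x) : C.finThird x y = .inl (-(x + y)) := by
  simp [finThird, h, hx, hy, h1, h2, h3]

/-- The possible positions of two different finite points. -/
theorem cases_of_ne {x y : R} (h : x ≠ y) :
    (x = 0 ∧ y ≠ 0) ∨ (y = 0 ∧ x ≠ 0) ∨ (x ≠ 0 ∧ y = -(2 * x)) ∨ (y ≠ 0 ∧ x = -(2 * y)) ∨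
      (x ≠ 0 ∧ y = -x) ∨
      (x ≠ 0 ∧ y ≠ 0 ∧ y ≠ -(2 * x) ∧ x ≠ -(2 * y) ∧ y ≠ -x) := by
  by_cases hx : x = 0
  · subst hx
    exact Or.inl ⟨rfl, h.symm⟩
  · tauto

theorem finThird_comm (C : DoublingColoring R) (x y : R) : C.finThird x y = C.finThird y x := by
  by_cases h : x = y
  · rw [h]
  rcases cases_of_ne h with ⟨rfl, hy⟩ | ⟨rfl, hx⟩ | ⟨hx, rfl⟩ | ⟨hy, rfl⟩ | ⟨hx, rfl⟩ |
    ⟨hx, hy, h1, h2, h3⟩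
  · rw [C.finThird_zero_left hy, C.finThird_zero_right hy]
  · rw [C.finThird_zero_left hx, C.finThird_zero_right hx]
  · rw [C.finThird_neg_two_mul hx, C.finThird_neg_two_mul_left hx]
  · rw [C.finThird_neg_two_mul hy, C.finThird_neg_two_mul_left hy]
  · have h1 := C.finThird_neg (neg_ne_zero.2 hx)
    rw [neg_neg, mul_neg] at h1
    simp only [C.exc_neg] at h1
    rw [h1, C.finThird_neg hx]
  · rw [C.finThird_of_ne h hx hy h1 h2 h3, C.finThird_of_ne (Ne.symm h) hy hx h2 h1, add_comm]
    exact fun h' => h3 (by rw [h', neg_neg])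

theorem zeroThird_ne_zero (C : DoublingColoring R) {x : R} (h : x ≠ 0) : C.zeroThird x ≠ 0 := by
  unfold zeroThird
  split_ifs
  · exact neg_ne_zero.2 (C.two_mul_ne_zero h)
  · exact neg_ne_zero.2 (C.half_mul_ne_zero h)
  · exact neg_ne_zero.2 h

theorem zeroThird_zeroThird (C : DoublingColoring R) (x : R) : C.zeroThird (C.zeroThird x) = x := by
  by_cases h1 : C.Exc x
  · simp [zeroThird, h1, C.exc_neg, C.not_exc_two_mul h1, C.half_mul_two_mul]
  · by_cases h2 : C.Exc (C.half * x)
    · simp [zeroThird, h1, h2, C.exc_neg, C.two_mul_half_mul]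
    · simp [zeroThird, h1, h2, C.exc_neg]

theorem third_inl_inr (C : DoublingColoring R) (x : R) (c : Bool) :
    C.third (.inl x) (C.infThird x c) = .inr c := by
  by_cases hx : x = 0
  · simp [infThird, hx, third]
  by_cases hc : C.color x = c
  · by_cases h1 : C.Exc x
    · have := C.color_of_exc h1
      simp only [infThird, hx, hc, h1, if_false, if_true, third, C.finThird_neg hx]
      rw [← this, hc]
    · simp only [infThird, hx, hc, h1, if_false, if_true, third, C.finThird_neg_two_mul hx]
  · by_cases h1 : C.Exc (C.half * x)
    · have h2 := C.color_of_exc_half h1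
      simp only [infThird, hx, hc, h1, if_false, if_true, third, C.finThird_neg hx,
        C.not_exc_of_half h1]
      rw [h2] at hc
      simpa using hc
    · have h2 := C.finThird_neg_two_mul_left (neg_ne_zero.2 (C.half_mul_ne_zero hx))
      rw [mul_neg, neg_neg, C.two_mul_half_mul] at h2
      simp only [infThird, hx, hc, h1, if_false, third, h2, C.exc_neg, C.color_neg,
        C.color_half hx h1]
      revert hc
      cases C.color x <;> cases c <;> simp

theorem third_inr_inl (C : DoublingColoring R) (x : R) (c : Bool) :
    C.third (.inr c) (C.infThird x c) = .inl x := by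
  by_cases hx : x = 0
  · simp [infThird, hx, third]
  by_cases hc : C.color x = c
  · by_cases h1 : C.Exc x
    · simp [infThird, hx, hc, h1, third, C.exc_neg, C.color_neg]
    · have h2 := C.color_two_mul_of_not_exc hx h1
      simp [infThird, hx, hc, h1, third, C.exc_neg, C.color_neg, h2, C.half_mul_two_mul,
        C.two_mul_ne_zero hx]
  · by_cases h1 : C.Exc (C.half * x)
    · simp [infThird, hx, hc, h1, third, C.exc_neg, C.color_neg]
    · have h2 := C.color_half hx h1
      have h3 : (!C.color x) = c := by
        revert hc
        cases C.color x <;> cases c <;> simp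
      simp [infThird, hx, hc, h1, third, C.exc_neg, C.color_neg, h2, h3, C.two_mul_half_mul,
        C.half_mul_ne_zero hx]

theorem third_inl_finThird (C : DoublingColoring R) (x y : R) :
    C.third (.inl x) (C.finThird x y) = .inl y := by
  by_cases h : x = y
  · simp [h, finThird, third]
  rcases cases_of_ne h with ⟨rfl, hy⟩ | ⟨rfl, hx⟩ | ⟨hx, rfl⟩ | ⟨hy, rfl⟩ | ⟨hx, rfl⟩ |
    ⟨hx, hy, h1, h2, h3⟩
  · rw [C.finThird_zero_left hy, third, C.finThird_zero_left (C.zeroThird_ne_zero hy),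
      C.zeroThird_zeroThird]
  · rw [C.finThird_zero_right hx, third]
    by_cases h1 : C.Exc x
    · simp [zeroThird, h1, C.finThird_neg_two_mul hx]
    · by_cases h2 : C.Exc (C.half * x)
      · have h3 := C.finThird_neg_two_mul_left (neg_ne_zero.2 (C.half_mul_ne_zero hx))
        rw [mul_neg, neg_neg, C.two_mul_half_mul] at h3
        simp [zeroThird, h1, h2, h3, C.exc_neg]
      · simp [zeroThird, h1, h2, C.finThird_neg hx]
  · rw [C.finThird_neg_two_mul hx]
    by_cases h1 : C.Exc x
    · simp [h1, third, C.finThird_zero_right hx, zeroThird]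
    · simp [h1, third, infThird, hx]
  · rw [C.finThird_neg_two_mul_left hy]
    by_cases h1 : C.Exc y
    · simp [h1, third, C.finThird_zero_right (neg_ne_zero.2 (C.two_mul_ne_zero hy)), zeroThird,
        C.exc_neg, C.not_exc_two_mul h1, C.half_mul_two_mul]
    · have h2 := C.color_two_mul_of_not_exc hy h1
      simp [h1, third, infThird, C.two_mul_ne_zero hy, C.color_neg, h2, C.exc_neg,
        C.half_mul_two_mul]
  · rw [C.finThird_neg hx]
    by_cases h1 : C.Exc x
    · simp [h1, third, infThird, hx, C.color_of_exc h1]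
    · by_cases h2 : C.Exc (C.half * x)
      · simp [h1, h2, third, infThird, hx, C.color_of_exc_half h2]
      · simp [h1, h2, third, C.finThird_zero_right hx, zeroThird]
  · rw [C.finThird_of_ne h hx hy h1 h2 h3, third, C.finThird_of_ne _ hx]
    · congr 1
      ring
    · exact fun h' => h3 (by linear_combination -h')
    · exact fun h' => h (by linear_combination h')
    · exact fun h' => h2 (by linear_combination -h')
    · exact fun h' => hy (by linear_combination -h')
    · exact fun h' => h1 (by linear_combination h')

/-- The Steiner quasigroup of a doubling colouring: the triples of sum zero, completed by two
infinite points along the cycles of `x ↦ -2x`, with a switch at each exceptional pair. -/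
def toSteinerQuasigroup (C : DoublingColoring R) : SteinerQuasigroup (R ⊕ Bool) where
  third := C.third
  third_self := by
    rintro (x | c) <;> simp [third, finThird]
  third_comm := by
    rintro (x | c) (y | d)
    · exact C.finThird_comm x y
    · rfl
    · rfl
    · simp only [third]
      by_cases h : c = d
      · simp [h]
      · simp [h, Ne.symm h]
  third_third := by
    rintro (x | c) (y | d)
    · exact C.third_inl_finThird x y
    · exact C.third_inl_inr x d
    · exact C.third_inr_inl y c
    · by_cases h : c = d
      · simp [third, h]
      · simp only [third, h, if_false, infThird, if_true]
        revert h
        cases c <;> cases d <;> simp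

/-- The triples one of which is met by every parallel class. -/
def special (C : DoublingColoring R) : Finset (Finset (R ⊕ Bool)) :=
  insert {.inl 0, .inr true, .inr false}
    (C.reps.image (fun x => {.inl 0, .inl x, .inl (-(2 * x))}) ∪
      (C.reps.image (fun x => {.inl 0, .inl (-x), .inl (2 * x)}) ∪
        C.reps.image fun x => {.inl x, .inl (-x), .inr true}))

theorem card_special_le (C : DoublingColoring R) : C.special.card ≤ 3 * C.reps.card + 1 := by
  have h1 := Finset.card_insert_le ({.inl 0, .inr true, .inr false} : Finset (R ⊕ Bool))
    (C.reps.image (fun x => {.inl 0, .inl x, .inl (-(2 * x))}) ∪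
      (C.reps.image (fun x => {.inl 0, .inl (-x), .inl (2 * x)}) ∪
        C.reps.image fun x => {.inl x, .inl (-x), .inr true}))
  refine h1.trans (Nat.add_le_add_right ?_ 1)
  refine (Finset.card_union_le _ _).trans ?_
  have h2 := Finset.card_union_le
    (C.reps.image (fun x => ({.inl 0, .inl (-x), .inl (2 * x)} : Finset (R ⊕ Bool))))
    (C.reps.image fun x => {.inl x, .inl (-x), .inr true})
  have h3 : ∀ f : R → Finset (R ⊕ Bool), (C.reps.image f).card ≤ C.reps.card := fun f =>
    Finset.card_image_le
  have h4 := h3 fun x => {.inl 0, .inl x, .inl (-(2 * x))}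
  have h5 := h3 fun x => {.inl 0, .inl (-x), .inl (2 * x)}
  have h6 := h3 fun x => {.inl x, .inl (-x), .inr true}
  omega

theorem inf_mem_special (C : DoublingColoring R) :
    {.inl 0, .inr true, .inr false} ∈ C.special := Finset.mem_insert_self _ _

theorem zero_mem_special (C : DoublingColoring R) {x : R} (h : C.Exc x) :
    {.inl 0, .inl x, .inl (-(2 * x))} ∈ C.special := by
  refine Finset.mem_insert_of_mem (Finset.mem_union.2 ?_)
  rcases h with h | h
  · exact Or.inl (Finset.mem_image_of_mem _ h)
  · exact Or.inr (Finset.mem_union_left _ (Finset.mem_image.2 ⟨-x, h, by simp⟩))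

theorem neg_mem_special (C : DoublingColoring R) {x : R} (h : C.Exc x) :
    {.inl x, .inl (-x), .inr true} ∈ C.special := by
  refine Finset.mem_insert_of_mem (Finset.mem_union_right _ (Finset.mem_union_right _ ?_))
  rcases h with h | h
  · exact Finset.mem_image_of_mem _ h
  · exact Finset.mem_image.2 ⟨-x, h, by rw [neg_neg, Finset.insert_comm]⟩

variable [Fintype R]

/-- Among the triples through 0, all but those of the form {0, y, -y} are special. -/
theorem sum_weight_of_zero_mem (C : DoublingColoring R) {t : Finset (R ⊕ Bool)}
    (ht : t ∈ C.toSteinerQuasigroup.toSteinerTripleSystem.triples) (h0 : .inl 0 ∈ t)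
    (hs : t ∉ C.special) : ∑ p ∈ t, weight p = 0 ∧ ∀ c, .inr c ∉ t := by
  obtain ⟨y | c, hne, rfl⟩ := C.toSteinerQuasigroup.exists_eq_of_mem ht h0
  · have hy : y ≠ 0 := fun h => hne (by rw [h])
    have h1 : C.toSteinerQuasigroup.third (.inl 0) (.inl y) = .inl (C.zeroThird y) :=
      C.finThird_zero_left hy
    rw [C.toSteinerQuasigroup.sum_triple hne, h1]
    rw [h1] at hs
    refine ⟨?_, by simp⟩
    unfold zeroThird at hs ⊢
    split_ifs at hs ⊢ with h2 h3
    · exact absurd (C.zero_mem_special h2) hs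
    · refine absurd (C.zero_mem_special ((C.exc_neg _).2 h3)) ?_
      rwa [mul_neg, neg_neg, C.two_mul_half_mul, Finset.pair_comm]
    · simp [weight]
  · exfalso
    apply hs
    have h1 : C.toSteinerQuasigroup.third (.inl 0) (.inr c) = .inr !c := by
      simp [toSteinerQuasigroup, third, infThird]
    rw [h1]
    cases c
    · rw [Finset.pair_comm]
      exact C.inf_mem_special
    · exact C.inf_mem_special

/-- What remains is {z, -2z, ∞_c} with z of colour `c` and sum -z, or the switched triple {2x, -2x,
∞_false} of sum 0. The latter need not be special, since a nonzero sum is still forced at ∞_true. -/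
theorem sum_weight_of_inr_mem (C : DoublingColoring R) {t : Finset (R ⊕ Bool)}
    (ht : t ∈ C.toSteinerQuasigroup.toSteinerTripleSystem.triples) {c : Bool} (hc : .inr c ∈ t)
    (h0 : .inl 0 ∉ t) (hs : t ∉ C.special) :
    ((c = false ∧ ∑ p ∈ t, weight p = 0) ∨
      ∃ x, x ≠ 0 ∧ C.color x = c ∧ ∑ p ∈ t, weight p = -x) ∧ ∀ d, .inr d ∈ t → d = c := by
  obtain ⟨x | d, hne, rfl⟩ := C.toSteinerQuasigroup.exists_eq_of_mem ht hc
  · have h1 : C.toSteinerQuasigroup.third (.inr c) (.inl x) = C.infThird x c := rfl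
    rw [C.toSteinerQuasigroup.sum_triple hne]
    rw [h1] at hs h0 ⊢
    have hx : x ≠ 0 := fun h => h0 (by simp [h])
    by_cases hxc : C.color x = c
    · by_cases h2 : C.Exc x
      · refine absurd (C.neg_mem_special h2) ?_
        have h3 : C.infThird x c = .inl (-x) := by simp [infThird, hx, hxc, h2]
        rw [h3] at hs
        rw [C.color_of_exc h2] at hxc
        rw [← hxc, Finset.insert_comm, Finset.pair_comm] at hs
        exact hs
      · have h3 : C.infThird x c = .inl (-(2 * x)) := by simp [infThird, hx, hxc, h2]
        rw [h3]
        refine ⟨Or.inr ⟨x, hx, hxc, ?_⟩, by simp⟩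
        simp only [weight, Sum.elim_inl, Sum.elim_inr, id, Pi.zero_apply]
        ring
    · by_cases h2 : C.Exc (C.half * x)
      · have h3 : C.infThird x c = .inl (-x) := by simp [infThird, hx, hxc, h2]
        rw [C.color_of_exc_half h2] at hxc
        rw [h3]
        exact ⟨Or.inl ⟨by simpa using Ne.symm hxc, by simp [weight]⟩, by simp⟩
      · have h3 : C.infThird x c = .inl (-(C.half * x)) := by simp [infThird, hx, hxc, h2]
        rw [h3]
        refine ⟨Or.inr ⟨-(C.half * x), neg_ne_zero.2 (C.half_mul_ne_zero hx), ?_, ?_⟩, by simp⟩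
        · rw [C.color_neg, C.color_half hx h2]
          revert hxc
          cases C.color x <;> cases c <;> simp
        · simp only [weight, Sum.elim_inl, Sum.elim_inr, id, Pi.zero_apply]
          linear_combination -C.two_mul_half_mul x
  · exfalso
    apply h0
    have h1 : c ≠ d := fun h => hne (by rw [h])
    simp [toSteinerQuasigroup, third, h1]

theorem sum_weight_of_notMem (C : DoublingColoring R) {t : Finset (R ⊕ Bool)}
    (ht : t ∈ C.toSteinerQuasigroup.toSteinerTripleSystem.triples) (h0 : .inl 0 ∉ t)
    (hc : ∀ c, .inr c ∉ t) : ∑ p ∈ t, weight p = 0 := by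
  obtain ⟨x | c, y | d, hne, rfl⟩ := C.toSteinerQuasigroup.mem_triples.1 ht
  · have h1 : C.toSteinerQuasigroup.third (.inl x) (.inl y) = C.finThird x y := rfl
    rw [C.toSteinerQuasigroup.sum_triple hne]
    rw [h1] at h0 hc ⊢
    simp only [Finset.mem_insert, Finset.mem_singleton, not_or, Sum.inl.injEq] at h0 hc
    have h : x ≠ y := fun h => hne (by rw [h])
    rcases cases_of_ne h with ⟨rfl, hy⟩ | ⟨rfl, hx⟩ | ⟨hx, rfl⟩ | ⟨hy, rfl⟩ | ⟨hx, rfl⟩ |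
      ⟨hx, hy, h1, h2, h3⟩
    · exact absurd rfl h0.1
    · exact absurd rfl h0.2.1
    · rw [C.finThird_neg_two_mul hx] at h0 hc
      split_ifs at h0 hc
      · exact absurd rfl h0.2.2
      · exact absurd rfl (hc _).2.2
    · rw [C.finThird_neg_two_mul_left hy] at h0 hc
      split_ifs at h0 hc
      · exact absurd rfl h0.2.2
      · exact absurd rfl (hc _).2.2
    · rw [C.finThird_neg hx] at h0 hc
      split_ifs at h0 hc
      · exact absurd rfl (hc _).2.2
      · exact absurd rfl (hc _).2.2
      · exact absurd rfl h0.2.2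
    · rw [C.finThird_of_ne h hx hy h1 h2 h3]
      simp only [weight, Sum.elim_inl, id]
      ring
  all_goals
    exfalso
    first
      | exact hc _ (Finset.mem_insert_self _ _)
      | exact hc _ (Finset.mem_insert_of_mem (Finset.mem_insert_self _ _))

/-- Otherwise only the triples through the two infinite points can have nonzero weight. They
contribute -x with x ≠ 0 of colour `true`, and either 0 or -y with y of colour `false`. The total is
0, so y = -x, but x and -x have the same colour. -/
theorem exists_mem_special (C : DoublingColoring R) {P : Finset (Finset (R ⊕ Bool))}
    (hP : C.toSteinerQuasigroup.toSteinerTripleSystem.IsParallelClass P) :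
    ∃ t ∈ P, t ∈ C.special := by
  by_contra! h
  obtain ⟨t, ht, ht0⟩ := hP.2 (.inl 0)
  obtain ⟨u, hu, hu1⟩ := hP.2 (.inr true)
  obtain ⟨s, hs, hs1⟩ := hP.2 (.inr false)
  obtain ⟨htw, htc⟩ := C.sum_weight_of_zero_mem (hP.1.1 ht) ht0 (h t ht)
  have hinj : ∀ {a b : Finset (R ⊕ Bool)} {p}, a ∈ P → b ∈ P → p ∈ a → p ∈ b → a = b :=
    fun {a b p} ha hb hpa hpb => by
      by_contra hab
      exact Finset.disjoint_left.1 (hP.1.2 a ha b hb hab) hpa hpb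
  have hu0 : .inl 0 ∉ u := fun h0 => htc true (hinj ht hu ht0 h0 ▸ hu1)
  have hs0 : .inl 0 ∉ s := fun h0 => htc false (hinj ht hs ht0 h0 ▸ hs1)
  obtain ⟨huw, huc⟩ := C.sum_weight_of_inr_mem (hP.1.1 hu) hu1 hu0 (h u hu)
  obtain ⟨hsw, hsc⟩ := C.sum_weight_of_inr_mem (hP.1.1 hs) hs1 hs0 (h s hs)
  have hus : u ≠ s := fun hus => by
    have := huc false (hus ▸ hs1)
    simp at this
  have hsum := hP.sum_sum weight
  rw [C.sum_weight, ← Finset.sum_subset (s₁ := {u, s})] at hsum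
  · rw [Finset.sum_pair hus] at hsum
    rcases huw with ⟨h1, -⟩ | ⟨x, hx, hxc, hxw⟩
    · simp at h1
    rcases hsw with ⟨-, h1⟩ | ⟨y, hy, hyc, hyw⟩
    · rw [hxw, h1] at hsum
      exact hx (by linear_combination -hsum)
    · rw [hxw, hyw] at hsum
      have h1 : y = -x := by linear_combination -hsum
      rw [h1, C.color_neg, hxc] at hyc
      simp at hyc
  · intro a ha
    simp only [Finset.mem_insert, Finset.mem_singleton] at ha
    rcases ha with rfl | rfl <;> assumption
  · intro a ha has
    simp only [Finset.mem_insert, Finset.mem_singleton, not_or] at has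
    by_cases h0 : .inl 0 ∈ a
    · exact (C.sum_weight_of_zero_mem (hP.1.1 ha) h0 (h a ha)).1
    · refine C.sum_weight_of_notMem (hP.1.1 ha) h0 fun c hc => ?_
      cases c
      · exact has.2 (hinj ha hs hc hs1)
      · exact has.1 (hinj ha hu hc hu1)

theorem exists_highIndex (C : DoublingColoring R) {v k : ℕ} (hv : v = 6 * k + 3)
    (hR : Fintype.card R + 2 = v) (hk : 3 * C.reps.card + 1 ≤ k) :
    ∃ S : SteinerTripleSystem (Fin v), ((v : ℚ) + 3) / 2 ≤ (S.chromaticIndex : ℚ) := by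
  have hV : Fintype.card (R ⊕ Bool) = v := by
    rw [Fintype.card_sum, Fintype.card_bool, hR]
  refine C.toSteinerQuasigroup.toSteinerTripleSystem.exists_fin_of_le_chromaticIndex hV hv ?_
  refine SteinerTripleSystem.le_chromaticIndex _ (hV.trans hv) C.special 1 ?_ fun P hP => ?_
  · have := C.card_special_le
    omega
  · obtain ⟨t, ht, hts⟩ := C.exists_mem_special hP
    exact ⟨{t}, by simpa using ht, by simpa using hts, by simp⟩

end DoublingColoring

/-! ### Orbits under doubling and negation. -/

namespace DoublingOrbit

variable {R : Type*} [CommRing R]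

/-- Equality up to sign. -/
def EqUpToSign (x y : R) : Prop := x = y ∨ x = -y

theorem EqUpToSign.symm {x y : R} (h : EqUpToSign x y) : EqUpToSign y x := by
  rcases h with rfl | rfl
  · exact Or.inl rfl
  · exact Or.inr (neg_neg y).symm

theorem EqUpToSign.trans {x y z : R} (h : EqUpToSign x y) (h' : EqUpToSign y z) :
    EqUpToSign x z := by
  rcases h with rfl | rfl <;> rcases h' with rfl | rfl
  · exact Or.inl rfl
  · exact Or.inr rfl
  · exact Or.inr rfl
  · exact Or.inl (neg_neg z)

theorem EqUpToSign.mul_left {x y : R} (h : EqUpToSign x y) (a : R) :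
    EqUpToSign (a * x) (a * y) := by
  rcases h with rfl | rfl
  · exact Or.inl rfl
  · exact Or.inr (mul_neg a y)

theorem eqUpToSign_neg (x : R) : EqUpToSign (-x) x := Or.inr rfl

/-- The orbits under doubling and negation, when two has finite multiplicative order. -/
def orbitSetoid (R : Type*) [CommRing R] {m : ℕ} (hm : 0 < m) (h2 : (2 : R) ^ m = 1) :
    Setoid R where
  r x y := ∃ i : ℕ, EqUpToSign y (2 ^ i * x)
  iseqv :=
    { refl := fun x => ⟨0, Or.inl (by simp)⟩
      symm := by
        rintro x y ⟨i, h⟩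
        -- After `i` doublings, `(m - 1) * i` more make `m * i` in all, which is the identity.
        refine ⟨(m - 1) * i, ((h.mul_left (2 ^ ((m - 1) * i))).trans (Or.inl ?_)).symm⟩
        obtain ⟨k, rfl⟩ : ∃ k, m = k + 1 := ⟨m - 1, by omega⟩
        rw [← mul_assoc, ← pow_add, Nat.add_sub_cancel, ← Nat.succ_mul, pow_mul, h2, one_pow,
          one_mul]
      trans := by
        rintro x y z ⟨i, h⟩ ⟨j, h'⟩
        refine ⟨j + i, h'.trans ((h.mul_left _).trans (Or.inl ?_))⟩
        rw [← mul_assoc, pow_add] }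

/-- Two has finite multiplicative order, and two and three are not zero divisors. -/
structure OrbitData (R : Type*) [CommRing R] where
  half : R
  two_mul_half : 2 * half = 1
  eq_zero_of_three_mul : ∀ x : R, 3 * x = 0 → x = 0
  order : ℕ
  order_pos : 0 < order
  two_pow_order : (2 : R) ^ order = 1

namespace OrbitData

variable (O : OrbitData R)

/-- The chosen representative of an orbit. -/
noncomputable def rep (x : R) : R :=
  Quotient.out (Quotient.mk (orbitSetoid R O.order_pos O.two_pow_order) x)

theorem exists_eq (x : R) : ∃ i : ℕ, EqUpToSign x (2 ^ i * O.rep x) :=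
  Quotient.mk_out (s := orbitSetoid R O.order_pos O.two_pow_order) x

theorem rep_eq {x y : R} {i : ℕ} (h : EqUpToSign y (2 ^ i * x)) : O.rep x = O.rep y :=
  congrArg Quotient.out (Quotient.sound (s := orbitSetoid R O.order_pos O.two_pow_order) ⟨i, h⟩)

theorem rep_rep (x : R) : O.rep (O.rep x) = O.rep x :=
  let ⟨_, h⟩ := O.exists_eq x
  O.rep_eq h

theorem rep_two_mul (x : R) : O.rep (2 * x) = O.rep x :=
  (O.rep_eq (i := 1) (Or.inl (by simp))).symm

open Classical in
/-- The number of doublings that lead from the representative of the orbit to `x`, up to sign. -/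
noncomputable def index (x : R) : ℕ := Nat.find (O.exists_eq x)

theorem index_spec (x : R) : EqUpToSign x (2 ^ O.index x * O.rep x) := by
  classical
  exact Nat.find_spec (O.exists_eq x)

theorem index_le {x : R} {i : ℕ} (h : EqUpToSign x (2 ^ i * O.rep x)) : O.index x ≤ i := by
  classical
  exact Nat.find_min' (O.exists_eq x) h

theorem index_congr {x y : R} (h : EqUpToSign x y) : O.index x = O.index y := by
  have hr : O.rep y = O.rep x := O.rep_eq (i := 0) (by simpa using h)
  refine le_antisymm (O.index_le ?_) (O.index_le ?_)
  · rw [← hr]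
    exact h.trans (O.index_spec y)
  · rw [hr]
    exact h.symm.trans (O.index_spec x)

theorem index_eq_zero {x : R} (h : EqUpToSign x (O.rep x)) : O.index x = 0 :=
  Nat.le_zero.1 (O.index_le (by simpa using h))

theorem eqUpToSign_of_two_mul (O : OrbitData R) {x y : R}
    (h : EqUpToSign (2 * x) (2 * y)) : EqUpToSign x y := by
  have h1 := h.mul_left O.half
  have h2 : ∀ z, O.half * (2 * z) = z := fun z => by linear_combination z * O.two_mul_half
  rwa [h2, h2] at h1

/-- The index grows with each doubling until the orbit closes up at its representative. -/
theorem index_two_mul {x : R} (h : ¬ EqUpToSign (2 * x) (O.rep x)) :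
    O.index (2 * x) = O.index x + 1 := by
  refine le_antisymm (O.index_le ?_) ?_
  · rw [O.rep_two_mul, pow_succ', mul_assoc]
    exact (O.index_spec x).mul_left 2
  · have h1 := O.index_spec (2 * x)
    rw [O.rep_two_mul] at h1
    cases h2 : O.index (2 * x) with
    | zero =>
      rw [h2] at h1
      exact absurd (by simpa using h1) h
    | succ j =>
      rw [h2, pow_succ', mul_assoc] at h1
      exact Nat.succ_le_succ (O.index_le (O.eqUpToSign_of_two_mul h1))

/-- Half the number of elements in the orbit of its representative `r`. -/
noncomputable def length (r : R) : ℕ := O.index (O.half * r) + 1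

theorem two_mul_half_mul (x : R) : 2 * (O.half * x) = x := by
  linear_combination x * O.two_mul_half

theorem rep_half (x : R) : O.rep (O.half * x) = O.rep x := by
  rw [← O.rep_two_mul, O.two_mul_half_mul]

/-- Half of `r` is the last element before the orbit closes, so one doubling more than its index
leads back to ±r. -/
theorem length_spec {r : R} (h : O.rep r = r) : EqUpToSign r (2 ^ O.length r * r) := by
  have h1 := (O.index_spec (O.half * r)).mul_left 2
  rwa [O.two_mul_half_mul, O.rep_half, h, ← mul_assoc, ← pow_succ'] at h1

theorem length_le {r : R} (h : O.rep r = r) {j : ℕ} (hj : 0 < j)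
    (hr : EqUpToSign r (2 ^ j * r)) : O.length r ≤ j := by
  obtain ⟨i, rfl⟩ : ∃ i, j = i + 1 := ⟨j - 1, by omega⟩
  refine Nat.succ_le_succ (O.index_le (O.eqUpToSign_of_two_mul ?_))
  rwa [O.two_mul_half_mul, O.rep_half, h, ← mul_assoc, ← pow_succ']

theorem eq_zero_of_two_pow_mul (O : OrbitData R) {x : R} {i : ℕ} (h : 2 ^ i * x = 0) : x = 0 := by
  induction i with
  | zero => simpa using h
  | succ i ih =>
    refine ih ?_
    rw [pow_succ'] at h
    linear_combination O.half * h - 2 ^ i * x * O.two_mul_half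

/-- 2r = ±r would give r = 0 or 3r = 0. Odd lengths are therefore at least 3. -/
theorem length_ne_one {r : R} (h : O.rep r = r) (h0 : r ≠ 0) : O.length r ≠ 1 := fun h1 => by
  have h2 := O.length_spec h
  rw [h1, pow_one] at h2
  rcases h2 with h2 | h2
  · exact h0 (by linear_combination -h2)
  · exact h0 (O.eq_zero_of_three_mul r (by linear_combination h2))

theorem eqUpToSign_cancel (O : OrbitData R) {x y : R} {i : ℕ}
    (h : EqUpToSign (2 ^ i * x) (2 ^ i * y)) :
    EqUpToSign x y := by
  induction i with
  | zero => simpa using h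
  | succ i ih =>
    rw [pow_succ', mul_assoc, mul_assoc] at h
    exact ih (O.eqUpToSign_of_two_mul h)

theorem eq_of_eqUpToSign_pow {r : R} (h : O.rep r = r) {i j : ℕ} (hi : i < O.length r)
    (hj : j < O.length r) (hij : EqUpToSign (2 ^ i * r) (2 ^ j * r)) : i = j := by
  wlog hlt : i < j generalizing i j
  · rcases Nat.lt_trichotomy i j with h1 | h1 | h1
    · exact absurd h1 hlt
    · exact h1
    · exact (this hj hi hij.symm h1).symm
  obtain ⟨k, rfl⟩ := Nat.exists_eq_add_of_lt hlt
  rw [add_assoc, pow_add, mul_assoc] at hij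
  have := O.length_le h (Nat.succ_pos k) (O.eqUpToSign_cancel hij)
  omega

section Finite

variable [Fintype R]

open Classical in
/-- The representatives of the nonzero orbits of odd length. -/
noncomputable def oddReps : Finset R :=
  Finset.univ.filter fun r => r ≠ 0 ∧ O.rep r = r ∧ Odd (O.length r)

theorem mem_oddReps {r : R} : r ∈ O.oddReps ↔ r ≠ 0 ∧ O.rep r = r ∧ Odd (O.length r) := by
  classical
  simp [oddReps]

/-- The sizes of the orbits in a set add up to at most the size of the set. -/
theorem sum_length_le (T : Finset R) (hT : T ⊆ O.oddReps) (A : Finset R)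
    (hA : ∀ r ∈ T, ∀ i, 2 ^ i * r ∈ A ∧ -(2 ^ i * r) ∈ A) :
    2 * ∑ r ∈ T, O.length r ≤ A.card := by
  classical
  have h1 : (T.sigma fun r => Finset.range (O.length r) ×ˢ (Finset.univ : Finset Bool)).card =
      2 * ∑ r ∈ T, O.length r := by
    rw [Finset.card_sigma, Finset.mul_sum]
    refine Finset.sum_congr rfl fun r _ => ?_
    simp [mul_comm]
  rw [← h1]
  -- An orbit is listed as ±2^i r with i below its length; these elements are distinct within and
  -- across orbits.
  let g : (Σ _ : R, ℕ × Bool) → R := fun p =>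
    if p.2.2 then 2 ^ p.2.1 * p.1 else -(2 ^ p.2.1 * p.1)
  have hg : ∀ p, EqUpToSign (g p) (2 ^ p.2.1 * p.1) := fun p => by
    simp only [g]
    split_ifs
    · exact Or.inl rfl
    · exact Or.inr rfl
  refine Finset.card_le_card_of_injOn g ?_ ?_
  · rintro ⟨r, i, b⟩ hp
    simp only [Finset.coe_sigma, Set.mem_sigma_iff, Finset.mem_coe] at hp
    cases b
    · exact (hA r hp.1 i).2
    · exact (hA r hp.1 i).1
  · rintro ⟨r, i, b⟩ hp ⟨s, j, c⟩ hq hpq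
    simp only [Finset.coe_sigma, Set.mem_sigma_iff, Finset.mem_coe, Finset.mem_product,
      Finset.mem_range] at hp hq
    obtain ⟨hr0, hr, -⟩ := O.mem_oddReps.1 (hT hp.1)
    obtain ⟨hs0, hs, -⟩ := O.mem_oddReps.1 (hT hq.1)
    have h3 := hg ⟨r, i, b⟩
    have h4 := hg ⟨s, j, c⟩
    rw [hpq] at h3
    simp only at h3 h4
    have h5 : r = s := by rw [← hr, ← hs, O.rep_eq h3, O.rep_eq h4]
    subst h5
    have h6 : i = j := O.eq_of_eqUpToSign_pow hr hp.2.1 hq.2.1 (h3.symm.trans h4)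
    subst h6
    have hne : 2 ^ i * r ≠ -(2 ^ i * r) := fun h => hr0 <| by
      refine O.eq_zero_of_two_pow_mul (i := i + 1) ?_
      rw [pow_succ']
      linear_combination h
    have h7 : b = c := by
      cases b <;> cases c <;> simp only [g, if_true, if_false, Bool.false_eq_true] at hpq
      · rfl
      · exact absurd hpq.symm hne
      · exact absurd hpq hne
      · rfl
    rw [h7]

/-- The doubling colouring that alternates along each orbit, with one exceptional pair in each
orbit of odd length. -/
noncomputable def doublingColoring : DoublingColoring R :=
  haveI : DecidableEq R := Classical.decEq R
  { half := O.half
    two_mul_half := O.two_mul_half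
    eq_zero_of_three_mul := O.eq_zero_of_three_mul
    -- The last element before an odd orbit closes has index `length - 1`, which is even, as is the
    -- index 0 of the representative that follows. This is the one place where the alternation
    -- fails.
    reps := O.oddReps.image fun r => O.half * r
    color := fun x => decide (Even (O.index x))
    zero_notMem := by
      intro h
      obtain ⟨r, hr, h⟩ := Finset.mem_image.1 h
      refine (O.mem_oddReps.1 hr).1 ?_
      rw [← O.two_mul_half_mul r, h, mul_zero]
    color_neg := fun x => by rw [O.index_congr (eqUpToSign_neg x)]
    color_two_mul := by
      intro x h0 hx hx'
      by_cases h : EqUpToSign (2 * x) (O.rep x)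
      · have h1 : O.index (2 * x) = 0 := O.index_eq_zero (by rwa [O.rep_two_mul])
        have h2 : EqUpToSign x (O.half * O.rep x) :=
          O.eqUpToSign_of_two_mul (by rwa [O.two_mul_half_mul])
        have h3 : ¬ Odd (O.length (O.rep x)) := by
          intro h3
          have h4 : O.rep x ∈ O.oddReps := by
            refine O.mem_oddReps.2 ⟨fun h4 => h0 ?_, O.rep_rep x, h3⟩
            have := O.index_spec x
            rw [h4, mul_zero] at this
            simpa [EqUpToSign] using this
          rcases h2 with h2 | h2
          · exact hx (Finset.mem_image.2 ⟨_, h4, h2.symm⟩)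
          · exact hx' (Finset.mem_image.2 ⟨_, h4, (neg_eq_iff_eq_neg.2 h2).symm⟩)
        rw [length, ← O.index_congr h2, Nat.odd_add_one, not_not, ← Nat.not_even_iff_odd] at h3
        simp [h1, h3]
      · rw [O.index_two_mul h]
        simp only [Nat.even_add_one]
        exact decide_not
    color_of_mem := by
      intro x hx
      obtain ⟨r, hr, rfl⟩ := Finset.mem_image.1 hx
      have h1 := (O.mem_oddReps.1 hr).2.2
      rw [length, Nat.odd_add_one, Nat.not_odd_iff_even] at h1
      simpa using h1
    color_two_mul_of_mem := by
      intro x hx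
      obtain ⟨r, hr, rfl⟩ := Finset.mem_image.1 hx
      have h1 : O.index r = 0 := O.index_eq_zero (Or.inl (O.mem_oddReps.1 hr).2.1.symm)
      simp [O.two_mul_half_mul, h1]
    two_mul_notMem := by
      -- Such an `r` and `s` would lie in one orbit, which would then have length one.
      have key : ∀ r ∈ O.oddReps, ∀ s ∈ O.oddReps, ¬ EqUpToSign r (O.half * s) := by
        intro r hr s hs h
        obtain ⟨hr0, hr1, -⟩ := O.mem_oddReps.1 hr
        obtain ⟨hs0, hs1, -⟩ := O.mem_oddReps.1 hs
        have h1 := h.symm.mul_left 2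
        rw [O.two_mul_half_mul] at h1
        have h2 : r = s := by
          rw [← hr1, ← hs1]
          exact O.rep_eq (i := 1) (by simpa using h1)
        subst h2
        have h3 := O.length_le hr1 one_pos (by simpa using h1)
        have h4 := O.length_ne_one hr1 hr0
        have h5 : 0 < O.length r := Nat.succ_pos _
        omega
      intro x hx
      obtain ⟨r, hr, rfl⟩ := Finset.mem_image.1 hx
      rw [O.two_mul_half_mul]
      constructor
      · intro h
        obtain ⟨s, hs, h⟩ := Finset.mem_image.1 h
        exact key r hr s hs (Or.inl h.symm)
      · intro h
        obtain ⟨s, hs, h⟩ := Finset.mem_image.1 h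
        exact key r hr s hs (Or.inr (by rw [h, neg_neg])) }

theorem card_reps_le : O.doublingColoring.reps.card ≤ O.oddReps.card := by
  classical
  exact Finset.card_image_le

theorem two_mul_sum_length_lt : 2 * ∑ r ∈ O.oddReps, O.length r < Fintype.card R := by
  classical
  have h0 : ∀ r ∈ O.oddReps, ∀ i, 2 ^ i * r ≠ 0 := fun r hr i h =>
    (O.mem_oddReps.1 hr).1 (O.eq_zero_of_two_pow_mul h)
  have := O.sum_length_le O.oddReps subset_rfl (Finset.univ.erase 0) fun r hr i =>
    ⟨Finset.mem_erase.2 ⟨h0 r hr i, Finset.mem_univ _⟩,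
      Finset.mem_erase.2 ⟨neg_ne_zero.2 (h0 r hr i), Finset.mem_univ _⟩⟩
  rw [Finset.card_erase_of_mem (Finset.mem_univ _), Finset.card_univ] at this
  have : 0 < Fintype.card R := Fintype.card_pos
  omega

end Finite

end OrbitData

/-! ### Counting the odd orbits in `ZMod n`. -/

/-- A solution has additive order dividing `n.gcd m`, and a cyclic group has at most `d` elements
killed by `d`. -/
theorem card_mul_eq_zero_le (n m : ℕ) [NeZero n] :
    (Finset.univ.filter fun x : ZMod n => (m : ZMod n) * x = 0).card ≤ n.gcd m := by
  have h1 := IsAddCyclic.card_nsmul_eq_zero_le (α := ZMod n)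
    (Nat.gcd_pos_of_pos_left m (NeZero.pos n))
  refine (Finset.card_le_card fun x hx => ?_).trans h1
  rw [Finset.mem_filter] at hx ⊢
  refine ⟨hx.1, ?_⟩
  rw [← addOrderOf_dvd_iff_nsmul_eq_zero]
  refine Nat.dvd_gcd ?_ ?_
  · rw [addOrderOf_dvd_iff_nsmul_eq_zero]
    simp
  · rw [addOrderOf_dvd_iff_nsmul_eq_zero, nsmul_eq_mul]
    exact hx.2

/-- A bound for the number of orbits of length `l` in `ZMod n`. -/
theorem card_filter_length_le {n : ℕ} [NeZero n] (O : OrbitData (ZMod n)) (l : ℕ) :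
    2 * l * (O.oddReps.filter fun r => O.length r = l).card ≤
      (n.gcd (2 ^ l - 1) - 1) + (n.gcd (2 ^ l + 1) - 1) := by
  classical
  let K : ℕ → Finset (ZMod n) := fun m => Finset.univ.filter fun x => (m : ZMod n) * x = 0
  have hK : ∀ m, ((K m).erase 0).card ≤ n.gcd m - 1 := fun m => by
    rw [Finset.card_erase_of_mem (by simp [K])]
    exact Nat.sub_le_sub_right (card_mul_eq_zero_le n m) 1
  -- If 2^l r = ±r, the whole orbit of `r` consists of nonzero solutions of (2^l - 1)x = 0 or of
  -- (2^l + 1)x = 0.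
  have h1 := O.sum_length_le (O.oddReps.filter fun r => O.length r = l)
    (Finset.filter_subset _ _) ((K (2 ^ l - 1)).erase 0 ∪ (K (2 ^ l + 1)).erase 0) ?_
  · rw [Finset.sum_congr rfl fun r hr => (Finset.mem_filter.1 hr).2, Finset.sum_const,
      smul_eq_mul] at h1
    have h2 := Finset.card_union_le ((K (2 ^ l - 1)).erase 0) ((K (2 ^ l + 1)).erase 0)
    have h3 := hK (2 ^ l - 1)
    have h4 := hK (2 ^ l + 1)
    calc _ = 2 * ((O.oddReps.filter fun r => O.length r = l).card * l) := by ring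
      _ ≤ _ := by omega
  · intro r hr i
    obtain ⟨hr, hl⟩ := Finset.mem_filter.1 hr
    obtain ⟨hr0, hr1, -⟩ := O.mem_oddReps.1 hr
    have h0 : 2 ^ i * r ≠ 0 := fun h => hr0 (O.eq_zero_of_two_pow_mul h)
    have h2 := O.length_spec hr1
    rw [hl] at h2
    have h3 : ((2 ^ l - 1 : ℕ) : ZMod n) = 2 ^ l - 1 := by
      rw [Nat.cast_sub Nat.one_le_two_pow]
      push_cast
      ring
    rcases h2 with h2 | h2
    · have h4 : ((2 ^ l - 1 : ℕ) : ZMod n) * (2 ^ i * r) = 0 := by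
        rw [h3]
        linear_combination -2 ^ i * h2
      constructor <;> refine Finset.mem_union_left _ (Finset.mem_erase.2 ⟨?_, ?_⟩)
      · exact h0
      · simpa [K] using h4
      · exact neg_ne_zero.2 h0
      · simpa [K] using h4
    · have h4 : ((2 ^ l + 1 : ℕ) : ZMod n) * (2 ^ i * r) = 0 := by
        push_cast
        linear_combination 2 ^ i * h2
      constructor <;> refine Finset.mem_union_right _ (Finset.mem_erase.2 ⟨?_, ?_⟩)
      · exact h0
      · simpa [K] using h4
      · exact neg_ne_zero.2 h0
      · simpa [K] using h4

/-- An orbit pays its length towards 13. Each shorter odd length l from 3 to 11 is compensated by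
the coefficient 13 - l. -/
theorem thirteen_mul_card_oddReps_le [Fintype R] (O : OrbitData R) :
    13 * O.oddReps.card ≤ ∑ r ∈ O.oddReps, O.length r +
      10 * (O.oddReps.filter fun r => O.length r = 3).card +
      8 * (O.oddReps.filter fun r => O.length r = 5).card +
      6 * (O.oddReps.filter fun r => O.length r = 7).card +
      4 * (O.oddReps.filter fun r => O.length r = 9).card +
      2 * (O.oddReps.filter fun r => O.length r = 11).card := by
  simp only [Finset.card_filter, Finset.mul_sum, ← Finset.sum_add_distrib]
  rw [mul_comm, ← smul_eq_mul, ← Finset.sum_const]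
  refine Finset.sum_le_sum fun r hr => ?_
  obtain ⟨h0, h1, h2⟩ := O.mem_oddReps.1 hr
  have h3 := O.length_ne_one h1 h0
  obtain ⟨k, hk⟩ := h2
  rw [hk] at h3 ⊢
  split_ifs <;> omega

/-- An upper bound for the number of orbits of length `l` in `ZMod n`. -/
def orbitBound (n l : ℕ) : ℕ := ((n.gcd (2 ^ l - 1) - 1) + (n.gcd (2 ^ l + 1) - 1)) / (2 * l)

/-- An upper bound for the number of orbits of odd length in `ZMod n`. -/
def oddOrbitBound (n : ℕ) : ℕ :=
  ((n - 1) / 2 + 10 * orbitBound n 3 + 8 * orbitBound n 5 + 6 * orbitBound n 7 +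
    4 * orbitBound n 9 + 2 * orbitBound n 11) / 13

theorem card_oddReps_le {n : ℕ} [NeZero n] (O : OrbitData (ZMod n)) :
    O.oddReps.card ≤ oddOrbitBound n := by
  have h : ∀ l, 0 < l → (O.oddReps.filter fun r => O.length r = l).card ≤ orbitBound n l :=
    fun l hl => by
      rw [orbitBound, Nat.le_div_iff_mul_le (by omega), mul_comm]
      exact card_filter_length_le O l
  have h1 := thirteen_mul_card_oddReps_le O
  have h2 := O.two_mul_sum_length_lt
  rw [ZMod.card] at h2
  have h3 := h 3 (by omega)
  have h5 := h 5 (by omega)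
  have h7 := h 7 (by omega)
  have h9 := h 9 (by omega)
  have h11 := h 11 (by omega)
  rw [oddOrbitBound, Nat.le_div_iff_mul_le (by omega)]
  omega

theorem orbitBound_le (n : ℕ) {l : ℕ} (hl : 0 < l) : orbitBound n l ≤ 2 ^ l / l := by
  have h0 : 1 < 2 ^ l := Nat.one_lt_two_pow hl.ne'
  have h1 := Nat.gcd_le_right n (show 0 < 2 ^ l + 1 by omega)
  have h2 := Nat.gcd_le_right n (show 0 < 2 ^ l - 1 by omega)
  rw [orbitBound, ← Nat.div_div_eq_div_mul]
  exact Nat.div_le_div_right (by omega)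

/-- The five short lengths contribute at most 20 + 48 + 108 + 224 + 372 = 772, so the bound is about
(n/2 + 772)/13, and 18/26 < 1 leaves room once `n` is large. -/
theorem oddOrbitBound_le_of_le {n : ℕ} (hn : 3600 ≤ n) : 18 * oddOrbitBound n + 7 ≤ n := by
  have h3 : orbitBound n 3 ≤ 2 := orbitBound_le n (by norm_num)
  have h5 : orbitBound n 5 ≤ 6 := orbitBound_le n (by norm_num)
  have h7 : orbitBound n 7 ≤ 18 := orbitBound_le n (by norm_num)
  have h9 : orbitBound n 9 ≤ 56 := orbitBound_le n (by norm_num)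
  have h11 : orbitBound n 11 ≤ 186 := orbitBound_le n (by norm_num)
  unfold oddOrbitBound
  omega

/-- The finite check below 3600. The values of `a` left out correspond to n = 1, 19, 73, 127 and n =
7, 43, 511. -/
theorem oddOrbitBound_le_of_lt : ∀ a < 200,
    (a ≠ 0 ∧ a ≠ 1 ∧ a ≠ 4 ∧ a ≠ 7 → 18 * oddOrbitBound (18 * a + 1) + 7 ≤ 18 * a + 1) ∧
    (a ≠ 0 ∧ a ≠ 2 ∧ a ≠ 28 → 18 * oddOrbitBound (18 * a + 7) + 7 ≤ 18 * a + 7) := by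
  decide +kernel

theorem oddOrbitBound_le {n : ℕ} (hn : n % 18 = 1 ∨ n % 18 = 7)
    (hne : n ≠ 1 ∧ n ≠ 7 ∧ n ≠ 19 ∧ n ≠ 43 ∧ n ≠ 73 ∧ n ≠ 127 ∧ n ≠ 511) :
    18 * oddOrbitBound n + 7 ≤ n := by
  rcases le_or_gt 3600 n with h | h
  · exact oddOrbitBound_le_of_le h
  · obtain ⟨h1, h2⟩ := oddOrbitBound_le_of_lt (n / 18) (by omega)
    rcases hn with hn | hn
    · have h3 : 18 * (n / 18) + 1 = n := by omega
      rw [h3] at h1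
      exact h1 (by omega)
    · have h3 : 18 * (n / 18) + 7 = n := by omega
      rw [h3] at h2
      exact h2 (by omega)

/-- The orbit data of `ZMod (6 * k + 1)`. -/
def zmodOrbitData (k : ℕ) : OrbitData (ZMod (6 * k + 1)) where
  half := (3 * k + 1 : ℕ)
  two_mul_half := by
    have : ((6 * k + 1 : ℕ) : ZMod (6 * k + 1)) = 0 := ZMod.natCast_self _
    push_cast at this ⊢
    linear_combination this
  eq_zero_of_three_mul := fun x hx => by
    have : ((6 * k + 1 : ℕ) : ZMod (6 * k + 1)) = 0 := ZMod.natCast_self _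
    push_cast at this
    linear_combination x * this - 2 * k * hx
  order := Nat.totient (6 * k + 1)
  order_pos := Nat.totient_pos.2 (by omega)
  two_pow_order := by
    have h : Nat.Coprime 2 (6 * k + 1) := by
      rw [Nat.coprime_two_left, Nat.odd_iff]
      omega
    have := (ZMod.natCast_eq_natCast_iff _ _ _).2 (Nat.ModEq.pow_totient h)
    simpa using this

end DoublingOrbit

/-! ### Orders congruent to 3 or 9 modulo 18. -/

theorem exists_highIndex_of_mod_eighteen_eq_three_or_nine {v : ℕ} (hv : v % 18 = 3 ∨ v % 18 = 9)
    (hne : v ≠ 3 ∧ v ≠ 9 ∧ v ≠ 21 ∧ v ≠ 45 ∧ v ≠ 75 ∧ v ≠ 129 ∧ v ≠ 513) :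
    ∃ S : SteinerTripleSystem (Fin v), ((v : ℚ) + 3) / 2 ≤ (S.chromaticIndex : ℚ) := by
  obtain ⟨k, rfl⟩ : ∃ k, v = 6 * k + 3 := ⟨v / 6, by omega⟩
  have h1 := DoublingOrbit.card_oddReps_le (DoublingOrbit.zmodOrbitData k)
  have h2 := (DoublingOrbit.zmodOrbitData k).card_reps_le
  -- With n = 6k + 1, the inequality 18b + 7 ≤ n is exactly 3b + 1 ≤ k, the room needed for the
  -- special triples.
  have h3 := DoublingOrbit.oddOrbitBound_le (n := 6 * k + 1) (by omega) (by omega)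
  refine (DoublingOrbit.zmodOrbitData k).doublingColoring.exists_highIndex rfl ?_ ?_
  · rw [ZMod.card]
  · omega

/-! ### Orders 3 and 9. -/

namespace SteinerTripleSystem

theorem chromaticIndex_le_one {V : Type*} [Fintype V] (hV : Fintype.card V = 3)
    (S : SteinerTripleSystem V) : S.chromaticIndex ≤ 1 := by
  have h : ∀ t ∈ S.triples, t = Finset.univ := fun t ht =>
    Finset.eq_univ_of_card t ((S.card_eq_three t ht).trans hV.symm)
  exact S.chromaticIndex_le_of_coloring (fun _ => ()) {()} (by simp)
    fun s hs t ht _ hst => absurd ((h s hs).trans (h t ht).symm) hst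

open Classical in
theorem card_triples_mem {V : Type*} [Fintype V] (S : SteinerTripleSystem V) (x : V) :
    2 * (S.triples.filter fun t => x ∈ t).card = Fintype.card V - 1 := by
  have h1 : (S.triples.filter fun t => x ∈ t).biUnion (fun t => t.erase x) =
      Finset.univ.erase x := by
    ext y
    simp only [Finset.mem_biUnion, Finset.mem_filter, Finset.mem_erase, Finset.mem_univ, and_true]
    constructor
    · rintro ⟨_, _, h, _⟩
      exact h
    · intro h
      obtain ⟨t, ⟨ht, hx, hy⟩, -⟩ := S.existsUnique_triple x y h.symm
      exact ⟨t, ⟨ht, hx⟩, h, hy⟩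
  have h2 := congrArg Finset.card h1
  rw [Finset.card_biUnion, Finset.card_erase_of_mem (Finset.mem_univ x), Finset.card_univ,
    Finset.sum_congr rfl (g := fun _ => 2)] at h2
  · rw [← h2, Finset.sum_const, smul_eq_mul, mul_comm]
  · intro t ht
    rw [Finset.mem_filter] at ht
    rw [Finset.card_erase_of_mem ht.2, S.card_eq_three t ht.1]
  · intro s hs t ht hst
    rw [Function.onFun, Finset.disjoint_left]
    intro y hys hyt
    rw [Finset.mem_coe, Finset.mem_filter] at hs ht
    rw [Finset.mem_erase] at hys hyt
    exact hst ((S.existsUnique_triple x y hys.1.symm).unique ⟨hs.1, hs.2, hys.2⟩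
      ⟨ht.1, ht.2, hyt.2⟩)

theorem eq_of_mem_of_mem {V : Type*} [Fintype V] (S : SteinerTripleSystem V) {s t : Finset V}
    (hs : s ∈ S.triples) (ht : t ∈ S.triples) {x y : V} (hxy : x ≠ y) (hxs : x ∈ s) (hys : y ∈ s)
    (hxt : x ∈ t) (hyt : y ∈ t) : s = t :=
  (S.existsUnique_triple x y hxy).unique ⟨hs, hxs, hys⟩ ⟨ht, hxt, hyt⟩

/-- In a system of order nine, exactly one triple through a point `x` misses a triple that does
not contain `x`. -/
theorem existsUnique_disjoint {V : Type*} [Fintype V] (hV : Fintype.card V = 9)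
    (S : SteinerTripleSystem V) {t : Finset V} (ht : t ∈ S.triples) {x : V} (hx : x ∉ t) :
    ∃! s, s ∈ S.triples ∧ x ∈ s ∧ Disjoint s t := by
  classical
  have hne : ∀ y ∈ t, x ≠ y := fun y hy h => hx (h ▸ hy)
  choose! f hf using fun (y : V) (hy : y ∈ t) => (S.existsUnique_triple x y (hne y hy)).exists
  -- Four triples pass through `x`. Those meeting `t` are the three that join `x` to the points of
  -- `t`, so one is left.
  have h1 : (S.triples.filter fun s => x ∈ s).filter (fun s => ¬ Disjoint s t) = t.image f := by
    ext s
    simp only [Finset.mem_filter, Finset.mem_image, Finset.not_disjoint_iff]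
    constructor
    · rintro ⟨⟨hs, hxs⟩, y, hys, hyt⟩
      obtain ⟨h1, h2, h3⟩ := hf y hyt
      exact ⟨y, hyt, S.eq_of_mem_of_mem h1 hs (hne y hyt) h2 h3 hxs hys⟩
    · rintro ⟨y, hyt, rfl⟩
      obtain ⟨h1, h2, h3⟩ := hf y hyt
      exact ⟨⟨h1, h2⟩, y, h3, hyt⟩
  have h2 : (t.image f).card = 3 := by
    rw [Finset.card_image_of_injOn, S.card_eq_three t ht]
    intro y hy z hz hyz
    by_contra hyz'
    obtain ⟨h1, h2, h3⟩ := hf y hy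
    obtain ⟨-, -, h4⟩ := hf z hz
    refine hx ?_
    rw [← S.eq_of_mem_of_mem h1 ht hyz' h3 (hyz ▸ h4) hy hz]
    exact h2
  have h3 := Finset.card_filter_add_card_filter_not (s := S.triples.filter fun s => x ∈ s)
    (fun s => Disjoint s t)
  have h4 := S.card_triples_mem x
  have h5 : (S.triples.filter fun s => x ∈ s).card = 4 := by
    rw [hV] at h4
    have : 2 * (S.triples.filter fun s => x ∈ s).card = 8 := by convert h4
    omega
  rw [h1, h2, h5] at h3
  obtain ⟨s, hs⟩ := Finset.card_eq_one.1 (show ((S.triples.filter fun s => x ∈ s).filter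
    fun s => Disjoint s t).card = 1 by omega)
  have h6 : ∀ u, (u ∈ S.triples ∧ x ∈ u ∧ Disjoint u t) ↔ u = s := fun u => by
    rw [← Finset.mem_singleton, ← hs, Finset.mem_filter, Finset.mem_filter, and_assoc]
  exact ⟨s, (h6 s).2 rfl, fun u hu => (h6 u).1 hu⟩

/-- Each triple is coloured by its parallel through a fixed point `p`. Two triples of one colour
meeting in a point off the colour triple would both be the parallel to it through that point. -/
theorem chromaticIndex_le_four {V : Type*} [Fintype V] (hV : Fintype.card V = 9)
    (S : SteinerTripleSystem V) : S.chromaticIndex ≤ 4 := by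
  classical
  obtain ⟨p⟩ : Nonempty V := Fintype.card_pos_iff.1 (by omega)
  have h0 : ∀ t ∈ S.triples, ∃ s, s ∈ S.triples ∧ p ∈ s ∧ (s = t ∨ Disjoint s t) := by
    intro t ht
    by_cases hp : p ∈ t
    · exact ⟨t, ht, hp, Or.inl rfl⟩
    · obtain ⟨s, ⟨h1, h2, h3⟩, -⟩ := S.existsUnique_disjoint hV ht hp
      exact ⟨s, h1, h2, Or.inr h3⟩
  choose! f hf using h0
  have h4 := S.card_triples_mem p
  rw [hV] at h4
  have h5 : (S.triples.filter fun s => p ∈ s).card = 4 := by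
    have : 2 * (S.triples.filter fun s => p ∈ s).card = 8 := by convert h4
    omega
  rw [← h5]
  refine S.chromaticIndex_le_of_coloring f _ (fun s hs => Finset.mem_filter.2
    ⟨(hf s hs).1, (hf s hs).2.1⟩) fun s hs t ht hst hne => ?_
  obtain ⟨h1, h2, h3⟩ := hf s hs
  obtain ⟨-, -, h6⟩ := hf t ht
  rw [← hst] at h6
  rcases h3 with h3 | h3
  · rcases h6 with h6 | h6
    · exact absurd (h3.symm.trans h6) hne
    · rwa [h3] at h6
  · rcases h6 with h6 | h6
    · rw [h6] at h3
      exact h3.symm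
    · rw [Finset.disjoint_left]
      intro y hys hyt
      have hy : y ∉ f s := fun h => Finset.disjoint_left.1 h3 h hys
      exact hne ((S.existsUnique_disjoint hV h1 hy).unique ⟨hs, hys, h3.symm⟩
        ⟨ht, hyt, h6.symm⟩)

end SteinerTripleSystem

theorem theorem1 (v : ℕ) (hv : v ≡ 3 [MOD 6]) :
    (v ∉ ({3, 9, 45, 75, 129, 513} : Set ℕ) →
      ∃ S : SteinerTripleSystem (Fin v), ((v : ℚ) + 3) / 2 ≤ (S.chromaticIndex : ℚ)) ∧
    (v ∈ ({3, 9} : Set ℕ) →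
      ∀ (V : Type*) [Fintype V], Fintype.card V = v →
        ¬ ∃ S : SteinerTripleSystem V, ((v : ℚ) + 3) / 2 ≤ (S.chromaticIndex : ℚ)) := by
  have hv6 : v % 6 = 3 := hv
  constructor
  · intro h
    simp only [Set.mem_insert_iff, Set.mem_singleton_iff, not_or] at h
    -- Order 21 needs its own system: modulo 19, the nonzero elements form a single orbit of length
    -- 9, and the required 3 · 1 + 1 ≤ k fails for k = 3.
    by_cases h21 : v = 21
    · subst h21
      exact exists_highIndex_twentyOne
    by_cases h15 : v % 18 = 15
    · exact exists_highIndex_of_mod_eighteen_eq_fifteen h15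
    · exact exists_highIndex_of_mod_eighteen_eq_three_or_nine (by omega) (by omega)
  · rintro h V _ hV ⟨S, hS⟩
    rcases h with rfl | h
    · have h1 : (S.chromaticIndex : ℚ) ≤ (1 : ℕ) := Nat.cast_le.2 (S.chromaticIndex_le_one hV)
      norm_num at h1 hS
      linarith
    · rw [Set.mem_singleton_iff] at h
      subst h
      have h1 : (S.chromaticIndex : ℚ) ≤ (4 : ℕ) := Nat.cast_le.2 (S.chromaticIndex_le_four hV)
      norm_num at h1 hS
      linarith
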